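/- All graphs are finite, simple and undirected. For an integer $d\ge 1$, a $(d,1)$-dominating set of $G=(V,E)$ is a set $S\subseteq V$ such that every $v\in V\setminus S$ has at least $d$ neighbours in $S$; the problem $(d,1)$-Domination asks for such a set of minimum size. A parse tree of $G$ is a rooted tree, in which every internal vertex has at least two children, that describes a construction of $G$ by the following operations: (O1) creation of a single vertex (the leaves of the tree; they are in bijection with $V$); (O2) disjoint union of two graphs; (O3) complete join of two graphs; (O4) substitution $H(G_1,\dots,G_\ell)$ of the vertices $1,\dots,\ell$ of an outline graph $H$ by vertex-disjoint graphs $G_1,\dots,G_\ell$ (all edges between $G_i$ and $G_j$ are present if $ij\in E(H)$, and none otherwise). The width of a parse tree is the maximum number of vertices of an outline graph used in an operation (O4), or $2$ if there is no such operation. The modular-width $\mathtt{mw}(G)$ is the minimum width of a parse tree of $G$. **Lemma.** There is an algorithm (a program of a unit-cost random access machine with addition, subtraction, comparison and indirect addressing) and an absolute constant $C$ such that the following holds. Given an integer $d\ge 1$ and a graph $G$ by a parse tree of $G$ of width $\mathtt{mw}(G)$ (written in postfix order, with the adjacency matrices of the outline graphs), the algorithm outputs the vertices of a minimum $(d,1)$-dominating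 set of $G$, and it halts after at most $C\cdot |V(G)|\cdot d\cdot (d+1)^{\mathtt{mw}(G)}$ steps. -/

import Mathlib

/-! ### Graphs: domination, parse trees, modular-width -/

/-- `S` is a `(d, r)`-dominating set of `G`: every vertex `v` outside `S` has at least `d` elements
of `S` in its neighbourhood of radius `r`, i.e. at distance at most `r` from `v` (the extended
distance is used, so that vertices in different components are at distance `∞`). -/
def IsDominatingSet {V : Type*} (G : SimpleGraph V) (d r : ℕ) (S : Finset V) : Prop :=
  ∀ v, v ∉ S → d ≤ {u : V | u ∈ S ∧ u ≠ v ∧ G.edist v u ≤ (r : ℕ∞)}.ncard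

/-- `S` is a solution of the `(d, r)`-Domination problem on `G`. -/
def IsMinimumDominatingSet {V : Type*} (G : SimpleGraph V) (d r : ℕ) (S : Finset V) : Prop :=
  IsDominatingSet G d r S ∧ ∀ S' : Finset V, IsDominatingSet G d r S' → S.card ≤ S'.card

/-- Expressions built from the four graph operations: an isolated vertex, the disjoint union of two
graphs, the complete join of two graphs, and the substitution of the vertices `0, …, ℓ - 1` of an
outline graph `H` by `ℓ` graphs. -/
inductive ParseTree (V : Type*) where
  | leaf (v : V) : ParseTree V
  | union (l r : ParseTree V) : ParseTree V
  | join (l r : ParseTree V) : ParseTree V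
  | subst (ℓ : ℕ) (H : SimpleGraph (Fin ℓ)) (c : Fin ℓ → ParseTree V) : ParseTree V

namespace ParseTree

variable {V : Type*}

/-- The vertices of the constructed graph. -/
def verts : ParseTree V → Set V
  | leaf v => {v}
  | union l r => l.verts ∪ r.verts
  | join l r => l.verts ∪ r.verts
  | subst _ _ c => ⋃ i, (c i).verts

/-- The adjacency relation of the constructed graph. -/
def Adj : ParseTree V → V → V → Prop
  | leaf _, _, _ => False
  | union l r, u, w => l.Adj u w ∨ r.Adj u w
  | join l r, u, w => l.Adj u w ∨ r.Adj u w ∨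
      (u ∈ l.verts ∧ w ∈ r.verts) ∨ (u ∈ r.verts ∧ w ∈ l.verts)
  | subst _ H c, u, w => (∃ i, (c i).Adj u w) ∨
      ∃ i j, H.Adj i j ∧ u ∈ (c i).verts ∧ w ∈ (c j).verts

/-- The graphs that are combined by an operation have disjoint vertex sets, and every internal
vertex of the tree has at least two children. -/
def WellFormed : ParseTree V → Prop
  | leaf _ => True
  | union l r => l.WellFormed ∧ r.WellFormed ∧ Disjoint l.verts r.verts
  | join l r => l.WellFormed ∧ r.WellFormed ∧ Disjoint l.verts r.verts
  | subst ℓ _ c => 2 ≤ ℓ ∧ (∀ i, (c i).WellFormed) ∧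
      ∀ i j, i ≠ j → Disjoint (c i).verts (c j).verts

/-- The width: the maximum number of vertices of an outline graph in a substitution, if there is
one, and `2` otherwise (outline graphs have at least two vertices in a well-formed tree). -/
def width : ParseTree V → ℕ
  | leaf _ => 2
  | union l r => max l.width r.width
  | join l r => max l.width r.width
  | subst ℓ _ c => max ℓ (Finset.univ.sup fun i => (c i).width)

/-- `T` is a parse tree of the graph `G`. -/
def IsParseTreeOf (T : ParseTree V) (G : SimpleGraph V) : Prop :=
  T.WellFormed ∧ (∀ v, v ∈ T.verts) ∧ ∀ u w, G.Adj u w ↔ T.Adj u w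

open Classical in
/-- The parse tree written down as a sequence of numbers, in postfix order: a leaf `v` is `0 v`, a
disjoint union is the code of its two children followed by `1`, a complete join is the code of its
two children followed by `2`, and a substitution is the code of its `ℓ` children followed by `3`,
`ℓ` and the rows of the `ℓ × ℓ` adjacency matrix of the outline graph. -/
noncomputable def encode {n : ℕ} : ParseTree (Fin n) → List ℕ
  | leaf v => [0, (v : ℕ)]
  | union l r => l.encode ++ r.encode ++ [1]
  | join l r => l.encode ++ r.encode ++ [2]
  | subst ℓ H c => (List.ofFn fun i => (c i).encode).flatten ++ [3, ℓ] ++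
      (List.ofFn fun i => List.ofFn fun j => if H.Adj i j then 1 else 0).flatten

end ParseTree

/-- The modular-width: the minimum width of a parse tree of `G`. -/
noncomputable def modularWidth {V : Type*} (G : SimpleGraph V) : ℕ :=
  sInf {w | ∃ T : ParseTree V, T.IsParseTreeOf G ∧ T.width = w}

/-- Every graph on `n ≥ 1` vertices has a parse tree whose width is the modular-width. -/
theorem exists_parseTree_width_eq {n : ℕ} (hn : 0 < n) (G : SimpleGraph (Fin n)) :
    ∃ T : ParseTree (Fin n), T.IsParseTreeOf G ∧ T.width = modularWidth G := by
  have key : ∃ T : ParseTree (Fin n), T.IsParseTreeOf G := by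
    rcases Nat.lt_or_ge n 2 with h | h
    · obtain rfl : n = 1 := by omega
      refine ⟨.leaf 0, trivial, fun v => ?_, fun u w => ?_⟩
      · exact Subsingleton.elim v 0
      · simp [ParseTree.Adj, Subsingleton.elim u w]
    · refine ⟨.subst n G .leaf, ⟨h, fun _ => trivial, fun i j hij => ?_⟩, fun v => ?_,
        fun u w => ?_⟩
      · simpa [ParseTree.verts] using hij
      · simp [ParseTree.verts]
      · simp [ParseTree.verts, ParseTree.Adj]
  obtain ⟨T, hT⟩ := key
  exact Nat.sInf_mem (s := {w | ∃ T : ParseTree (Fin n), T.IsParseTreeOf G ∧ T.width = w})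
    ⟨_, T, hT, rfl⟩

/-! ### Unit-cost random access machine -/

namespace RAM

/-- A state of the machine: named registers, and a memory with indirect access. -/
structure State where
  reg : ℕ → ℕ
  mem : ℕ → ℕ

/-- Assign the value `x` to register `r`. -/
def State.setReg (σ : State) (r x : ℕ) : State := { σ with reg := Function.update σ.reg r x }

/-- Write the value `x` into the memory cell with address `a`. -/
def State.setMem (σ : State) (a x : ℕ) : State := { σ with mem := Function.update σ.mem a x }

/-- Programs over the usual RAM instructions (no multiplication), with structured control flow. A
program mentions finitely many registers and constants. -/
inductive Program where
  /-- `reg r := k` -/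
  | const (r k : ℕ) : Program
  /-- `reg r := reg a` -/
  | copy (r a : ℕ) : Program
  /-- `reg r := reg a + reg b` -/
  | add (r a b : ℕ) : Program
  /-- `reg r := reg a - reg b`, truncated at `0` -/
  | sub (r a b : ℕ) : Program
  /-- `reg r := mem (reg a)` -/
  | load (r a : ℕ) : Program
  /-- `mem (reg a) := reg r` -/
  | store (a r : ℕ) : Program
  /-- `p; q` -/
  | seq (p q : Program) : Program
  /-- `if reg a < reg b then p else q` -/
  | ite (a b : ℕ) (p q : Program) : Program
  /-- `while reg a < reg b do p` -/
  | while (a b : ℕ) (p : Program) : Program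

/-- `Exec p σ t τ`: started in the state `σ`, the program `p` halts in the state `τ` after exactly
`t` steps. Every instruction and every evaluation of a test is one step. -/
inductive Exec : Program → State → ℕ → State → Prop
  | const (r k : ℕ) (σ : State) : Exec (.const r k) σ 1 (σ.setReg r k)
  | copy (r a : ℕ) (σ : State) : Exec (.copy r a) σ 1 (σ.setReg r (σ.reg a))
  | add (r a b : ℕ) (σ : State) : Exec (.add r a b) σ 1 (σ.setReg r (σ.reg a + σ.reg b))
  | sub (r a b : ℕ) (σ : State) : Exec (.sub r a b) σ 1 (σ.setReg r (σ.reg a - σ.reg b))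
  | load (r a : ℕ) (σ : State) : Exec (.load r a) σ 1 (σ.setReg r (σ.mem (σ.reg a)))
  | store (a r : ℕ) (σ : State) : Exec (.store a r) σ 1 (σ.setMem (σ.reg a) (σ.reg r))
  | seq {p q : Program} {σ τ ρ : State} {t u : ℕ} :
      Exec p σ t τ → Exec q τ u ρ → Exec (.seq p q) σ (t + u) ρ
  | ite_true {a b : ℕ} {p q : Program} {σ τ : State} {t : ℕ} :
      σ.reg a < σ.reg b → Exec p σ t τ → Exec (.ite a b p q) σ (t + 1) τ
  | ite_false {a b : ℕ} {p q : Program} {σ τ : State} {t : ℕ} :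
      ¬ σ.reg a < σ.reg b → Exec q σ t τ → Exec (.ite a b p q) σ (t + 1) τ
  | while_true {a b : ℕ} {p : Program} {σ τ ρ : State} {t u : ℕ} :
      σ.reg a < σ.reg b → Exec p σ t τ → Exec (.while a b p) τ u ρ →
      Exec (.while a b p) σ (t + u + 1) ρ
  | while_false {a b : ℕ} {p : Program} {σ : State} :
      ¬ σ.reg a < σ.reg b → Exec (.while a b p) σ 1 σ

/-- The machine is deterministic. -/
theorem Exec.deterministic {p : Program} {σ τ τ' : State} {t t' : ℕ}
    (h : Exec p σ t τ) (h' : Exec p σ t' τ') : t = t' ∧ τ = τ' := by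
  induction h generalizing t' τ' with
  | const | copy | add | sub | load | store => cases h'; exact ⟨rfl, rfl⟩
  | seq _ _ ih₁ ih₂ =>
    cases h' with
    | seq h₁ h₂ =>
      obtain ⟨rfl, rfl⟩ := ih₁ h₁
      obtain ⟨rfl, rfl⟩ := ih₂ h₂
      exact ⟨rfl, rfl⟩
  | ite_true hc _ ih =>
    cases h' with
    | ite_true _ h₁ => obtain ⟨rfl, rfl⟩ := ih h₁; exact ⟨rfl, rfl⟩
    | ite_false hn _ => exact absurd hc hn
  | ite_false hc _ ih =>
    cases h' with
    | ite_true hn _ => exact absurd hn hc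
    | ite_false _ h₁ => obtain ⟨rfl, rfl⟩ := ih h₁; exact ⟨rfl, rfl⟩
  | while_true hc _ _ ih₁ ih₂ =>
    cases h' with
    | while_true _ h₁ h₂ =>
      obtain ⟨rfl, rfl⟩ := ih₁ h₁
      obtain ⟨rfl, rfl⟩ := ih₂ h₂
      exact ⟨rfl, rfl⟩
    | while_false hn => exact absurd hc hn
  | while_false hc =>
    cases h' with
    | while_true hn _ _ => exact absurd hn hc
    | while_false _ => exact ⟨rfl, rfl⟩

/-- The start state on an input list: the list is stored in the memory cells `0, 1, …`, its length
is in register `0`, and everything else is `0`. -/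
def init (input : List ℕ) : State where
  reg := Function.update (fun _ => 0) 0 input.length
  mem := fun a => input.getD a 0

/-- The output list of a state: register `0` holds its length, the memory cells `0, 1, …` hold its
entries. -/
def output (σ : State) : List ℕ := (List.range (σ.reg 0)).map σ.mem

/-- On the given input, `p` halts after exactly `t` steps with the output `out`. -/
def Computes (p : Program) (input out : List ℕ) (t : ℕ) : Prop :=
  ∃ τ : State, Exec p (init input) t τ ∧ output τ = out

end RAM

/-! The algorithm is a dynamic program over the parse tree. For the graph built by a subtree, with
vertex set `W`, and for every demand `r ≤ d`, it stores the least size of a set `S ⊆ W` such that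
each vertex of `W \ S` has at least `r` neighbours in `S`. The answer is the entry for `r = d` at
the root.

Consider a substitution with parts `W 0, …, W (l - 1)`. All vertices of one part `W i` see the same
chosen vertices outside of it, namely those in the parts adjacent to `i`. So it suffices to guess
the truncated sizes `σ i = min |S ∩ W i| d`: part `i` receives `k i = ∑ σ j` over the adjacent `j`,
is left with the demand `r - k i`, and contributes the maximum of its entry for that demand and `σ
i`. Truncation loses nothing: if `k i < r ≤ d`, no adjacent size was truncated (`exists_sizes`).
Conversely, parts that meet the remaining demands and have at least the guessed sizes fit together
(`sat_substAdj`). Union and join are substitutions into the two graphs on two vertices.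

There are at most `(d + 1) ^ l` guesses, and each is evaluated for all demands at once in `O(l * d)`
steps. Lowering all demands of a table by one only duplicates the head of a linked list
(`shift_shifted`), so it takes constant time and leaves the old table intact; the guesses can
therefore be enumerated as a tree. The sum of the numbers `l` over the whole parse tree is linear in
the number of vertices; this amortisation is the credit carried by `ParseOK`. Explicit solution sets
would be too expensive to copy, so the tables hold descriptions `Sol` of linear size, expanded once
at the end (`emitAll_eq`).

On the machine side, `Sim` lets a program act on immutable binary trees in a heap that only grows.
The predicates `Run` and `Fast` are closed under composition, pairing, case distinction and folds,
so a program for the algorithm is obtained by following its functional definition, together with a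
cost function that is bounded separately. -/

/-! ### Immutable data in the memory of the machine -/

namespace RAM

/-- Binary trees of numbers. -/
inductive Val where
  | num (n : ℕ) : Val
  | pair (a b : Val) : Val

/-- The number `x` represents the value `v` in the cells `lo, …, h - 1` of the memory `m`: a number
represents itself, a pair is represented by the address of its first component, which is followed by
its second one. -/
def Rep (lo : ℕ) (m : ℕ → ℕ) (h : ℕ) : Val → ℕ → Prop
  | .num n, x => x = n
  | .pair a b, x => lo ≤ x ∧ x + 1 < h ∧ Rep lo m h a (m x) ∧ Rep lo m h b (m (x + 1))

/-- A represented value reads only cells between `lo` and `h`. Cells below `lo` may change, which is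
what allows the output to overwrite the input area while the result is still being read. -/
theorem Rep.congr {lo : ℕ} {m m' : ℕ → ℕ} {h h' : ℕ} (hm : ∀ a, lo ≤ a → a < h → m' a = m a)
    (hh : h ≤ h') : ∀ {v : Val} {x : ℕ}, Rep lo m h v x → Rep lo m' h' v x
  | .num _, _, hx => hx
  | .pair _ _, x, ⟨h0, h1, ha, hb⟩ => by
    refine ⟨h0, by omega, ?_, ?_⟩
    · rw [hm x h0 (by omega)]; exact ha.congr hm hh
    · rw [hm (x + 1) (by omega) h1]; exact hb.congr hm hh

theorem Rep.mono {lo : ℕ} {m m' : ℕ → ℕ} {h h' : ℕ} (hm : ∀ a < h, m' a = m a) (hh : h ≤ h')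
    {v : Val} {x : ℕ} (hr : Rep lo m h v x) : Rep lo m' h' v x :=
  hr.congr (fun a _ ha => hm a ha) hh

theorem Exec.of_eq {p : Program} {σ τ : State} {t t' : ℕ} (h : Exec p σ t τ) (ht : t = t') :
    Exec p σ t' τ := ht ▸ h

/-- The program `p` turns the value `v` of register `1` into `w` within `t` steps. Register `3` is
the first free address; the memory below it and the stack pointer in register `2` are preserved. -/
def Sim (p : Program) (v : Val) (t : ℕ) (w : Val) : Prop :=
  ∀ (lo : ℕ) (σ : State), 0 < lo → lo ≤ σ.reg 3 → Rep lo σ.mem (σ.reg 3) v (σ.reg 1) →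
    ∃ τ t', Exec p σ t' τ ∧ t' ≤ t ∧ σ.reg 3 ≤ τ.reg 3 ∧ (∀ a < σ.reg 3, τ.mem a = σ.mem a) ∧
      τ.reg 2 = σ.reg 2 ∧ Rep lo τ.mem (τ.reg 3) w (τ.reg 1)

theorem Sim.mono {p : Program} {v w : Val} {t t' : ℕ} (h : Sim p v t w) (ht : t ≤ t') :
    Sim p v t' w := by
  intro lo σ hlo h0 hr
  obtain ⟨τ, s, he, hs, h1⟩ := h lo σ hlo h0 hr
  exact ⟨τ, s, he, hs.trans ht, h1⟩

theorem Sim.seq {p q : Program} {u v w : Val} {s t : ℕ} (hp : Sim p u s v) (hq : Sim q v t w) :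
    Sim (.seq p q) u (s + t) w := by
  intro lo σ hlo h0 hr
  obtain ⟨τ, s', he, hs, h1, h2, h3, h4⟩ := hp lo σ hlo h0 hr
  obtain ⟨ρ, t', he', ht, h1', h2', h3', h4'⟩ := hq lo τ hlo (by omega) h4
  refine ⟨ρ, s' + t', .seq he he', by omega, by omega, fun a ha => ?_, by rw [h3', h3], h4'⟩
  rw [h2' a (by omega), h2 a ha]

theorem Sim.id (v : Val) : Sim (.copy 1 1) v 1 v := by
  intro lo σ hlo h0 hr
  exact ⟨_, _, .copy .., le_rfl, by simp [State.setReg], by simp [State.setReg],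
    by simp [State.setReg], by simpa [State.setReg] using hr⟩

theorem Sim.const (n : ℕ) (v : Val) : Sim (.const 1 n) v 1 (.num n) := by
  intro lo σ hlo h0 hr
  exact ⟨_, _, .const .., le_rfl, by simp [State.setReg], by simp [State.setReg],
    by simp [State.setReg], by simp [State.setReg, Rep]⟩

theorem Sim.fst (v w : Val) : Sim (.load 1 1) (.pair v w) 1 v := by
  intro lo σ hlo h0 hr
  exact ⟨_, _, .load .., le_rfl, by simp [State.setReg], by simp [State.setReg],
    by simp [State.setReg], by simpa [State.setReg] using hr.2.2.1⟩

/-- Second component of a pair. -/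
def Program.snd : Program := .seq (.const 4 1) (.seq (.add 1 1 4) (.load 1 1))

theorem Sim.snd (v w : Val) : Sim .snd (.pair v w) 3 w := by
  intro lo σ hlo h0 hr
  exact ⟨_, _, .seq (.const ..) (.seq (.add ..) (.load ..)), le_rfl, by simp [State.setReg],
    by simp [State.setReg], by simp [State.setReg], by simpa [State.setReg] using hr.2.2.2⟩

/-- Push register `1` on the stack. -/
def Program.push : Program :=
  .seq (.store 3 1) <| .seq (.const 4 1) <| .seq (.add 3 3 4) <| .seq (.store 3 2) <|
    .seq (.sub 2 3 4) (.add 3 3 4)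

theorem exec_push (σ : State) : ∃ τ, Exec .push σ 6 τ ∧ τ.reg 1 = σ.reg 1 ∧ τ.reg 2 = σ.reg 3 ∧
    τ.reg 3 = σ.reg 3 + 2 ∧ τ.reg 6 = σ.reg 6 ∧ τ.mem (σ.reg 3) = σ.reg 1 ∧
    τ.mem (σ.reg 3 + 1) = σ.reg 2 ∧ ∀ a < σ.reg 3, τ.mem a = σ.mem a := by
  refine ⟨_, .seq (.store ..) <| .seq (.const ..) <| .seq (.add ..) <| .seq (.store ..) <|
    .seq (.sub ..) (.add ..), ?_⟩
  simp [State.setReg, State.setMem, Function.update_apply]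
  intro a ha
  rw [if_neg (by omega), if_neg (by omega)]

/-- Pop the stack into register `6`. -/
def Program.pop : Program :=
  .seq (.load 6 2) <| .seq (.const 4 1) <| .seq (.add 2 2 4) (.load 2 2)

theorem exec_pop (σ : State) : ∃ τ, Exec .pop σ 4 τ ∧ τ.reg 1 = σ.reg 1 ∧
    τ.reg 2 = σ.mem (σ.reg 2 + 1) ∧ τ.reg 3 = σ.reg 3 ∧ τ.reg 6 = σ.mem (σ.reg 2) ∧
    τ.mem = σ.mem := by
  refine ⟨_, .seq (.load ..) <| .seq (.const ..) <| .seq (.add ..) (.load ..), ?_⟩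
  simp [State.setReg]

/-- Allocate the pair of the registers `6` and `1`. -/
def Program.alloc : Program :=
  .seq (.store 3 6) <| .seq (.const 4 1) <| .seq (.add 3 3 4) <| .seq (.store 3 1) <|
    .seq (.sub 1 3 4) (.add 3 3 4)

theorem exec_alloc (σ : State) : ∃ τ, Exec .alloc σ 6 τ ∧ τ.reg 1 = σ.reg 3 ∧ τ.reg 2 = σ.reg 2 ∧
    τ.reg 3 = σ.reg 3 + 2 ∧ τ.mem (σ.reg 3) = σ.reg 6 ∧
    τ.mem (σ.reg 3 + 1) = σ.reg 1 ∧ (∀ a < σ.reg 3, τ.mem a = σ.mem a) ∧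
    ∀ r > 6, τ.reg r = σ.reg r := by
  refine ⟨_, .seq (.store ..) <| .seq (.const ..) <| .seq (.add ..) <| .seq (.store ..) <|
    .seq (.sub ..) (.add ..), ?_⟩
  simp [State.setReg, State.setMem, Function.update_apply]
  refine ⟨fun a ha => ?_, fun r hr => ?_⟩
  · rw [if_neg (by omega), if_neg (by omega)]
  · repeat rw [if_neg (by omega)]

/-- The pair of the results of two programs. -/
def Program.both (p q : Program) : Program :=
  .seq .push <| .seq p <| .seq .pop <| .seq .push <| .seq (.copy 1 6) <| .seq q <|
    .seq .pop .alloc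

/-- The input is kept on the stack while `p` runs and the result of `p` while `q` runs. The stack is
itself a linked list in the heap, so both programs preserve its contents along with the rest of the
memory below the free address. -/
theorem Sim.both {p q : Program} {u v w : Val} {s t : ℕ} (hp : Sim p u s v) (hq : Sim q u t w) :
    Sim (.both p q) u (s + t + 27) (.pair v w) := by
  intro lo σ hlo h0 hr
  obtain ⟨σ₁, e₁, a1, a2, a3, -, a4, a5, a6⟩ := exec_push σ
  have hr₁ : Rep lo σ₁.mem (σ₁.reg 3) u (σ₁.reg 1) := by
    rw [a1]; exact hr.mono a6 (by omega)
  obtain ⟨σ₂, t₂, e₂, b1, b2, b3, b4, b5⟩ := hp lo σ₁ hlo (by omega) hr₁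
  obtain ⟨σ₃, e₃, c1, c2, c3, c4, c5⟩ := exec_pop σ₂
  obtain ⟨σ₄, e₄, d1, d2, d3, d4, d5, d6, d7⟩ := exec_push σ₃
  have hm : ∀ a < σ₁.reg 3, σ₄.mem a = σ₁.mem a := fun a ha => by
    rw [d7 a (by omega), c5, b3 a ha]
  have h6 : σ₄.reg 6 = σ.reg 1 := by rw [d4, c4, b4, a2, b3 _ (by omega), a4]
  have hS : σ₃.reg 2 = σ.reg 2 := by rw [c2, b4, a2, b3 _ (by omega), a5]
  let σ₅ := σ₄.setReg 1 (σ₄.reg 6)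
  have e₅ : Exec (.copy 1 6) σ₄ 1 σ₅ := .copy ..
  have f1 : σ₅.reg 1 = σ.reg 1 := by simp [σ₅, State.setReg, h6]
  have f2 : σ₅.reg 2 = σ₃.reg 3 := by simp [σ₅, State.setReg, d2]
  have f3 : σ₅.reg 3 = σ₃.reg 3 + 2 := by simp [σ₅, State.setReg, d3]
  have f4 : σ₅.mem = σ₄.mem := rfl
  have hr₅ : Rep lo σ₅.mem (σ₅.reg 3) u (σ₅.reg 1) := by
    rw [f1, f4, ← a1]; exact hr₁.mono hm (by omega)
  obtain ⟨σ₆, t₆, e₆, g1, g2, g3, g4, g5⟩ := hq lo σ₅ hlo (by omega) hr₅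
  obtain ⟨σ₇, e₇, i1, i2, i3, i4, i5⟩ := exec_pop σ₆
  obtain ⟨σ₈, e₈, j1, j2, j3, j4, j5, j6, -⟩ := exec_alloc σ₇
  have h26 : ∀ a < σ₂.reg 3, σ₆.mem a = σ₂.mem a := fun a ha => by
    rw [g3 a (by omega), f4, d7 a (by omega), c5]
  refine ⟨σ₈, _, .seq e₁ <| .seq e₂ <| .seq e₃ <| .seq e₄ <| .seq e₅ <| .seq e₆ <| .seq e₇ e₈,
    by omega, by omega, fun a ha => ?_, ?_, ?_, by omega, ?_, ?_⟩
  · rw [j6 a (by omega), i5, h26 a (by omega), b3 a (by omega), a6 a ha]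
  · rw [j2, i2, g4, f2, g3 _ (by omega), f4, d6, hS]
  · omega
  · rw [j1, j4, i4, g4, f2, g3 _ (by omega), f4, d5, c1]
    exact b5.mono (fun a ha => by rw [j6 a (by omega), i5, h26 a ha]) (by omega)
  · rw [j1, j5, i1]
    exact g5.mono (fun a ha => by rw [j6 a (by omega), i5]) (by omega)

/-- Load the components of a pair into the registers `6` and `1`. -/
def Program.open : Program := .seq (.load 6 1) .snd

theorem exec_open (σ : State) : ∃ τ, Exec .open σ 4 τ ∧ τ.reg 1 = σ.mem (σ.reg 1 + 1) ∧
    τ.reg 2 = σ.reg 2 ∧ τ.reg 3 = σ.reg 3 ∧ τ.reg 6 = σ.mem (σ.reg 1) ∧ τ.mem = σ.mem := by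
  refine ⟨_, .seq (.load ..) <| .seq (.const ..) <| .seq (.add ..) (.load ..), ?_⟩
  simp [State.setReg]

theorem Sim.add (a b : ℕ) : Sim (.seq .open (.add 1 6 1)) (.pair (.num a) (.num b)) 5
    (.num (a + b)) := by
  intro lo σ hlo h0 hr
  obtain ⟨σ₁, e₁, a1, a2, a3, a4, a5⟩ := exec_open σ
  refine ⟨_, _, .seq e₁ (.add ..), le_rfl, ?_⟩
  simp only [Rep] at hr
  simp [State.setReg, Rep, *]

theorem Sim.sub (a b : ℕ) : Sim (.seq .open (.sub 1 6 1)) (.pair (.num a) (.num b)) 5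
    (.num (a - b)) := by
  intro lo σ hlo h0 hr
  obtain ⟨σ₁, e₁, a1, a2, a3, a4, a5⟩ := exec_open σ
  refine ⟨_, _, .seq e₁ (.sub ..), le_rfl, ?_⟩
  simp only [Rep] at hr
  simp [State.setReg, Rep, *]

/-- The values that are not represented by the number `0`. -/
def Val.NonZero : Val → Prop
  | .num n => 0 < n
  | .pair _ _ => True

/-- Addresses are at least `lo > 0`, so a single comparison with `0` separates pairs from the number
`0`; no tags are needed. -/
theorem Rep.pos_iff {lo : ℕ} {m : ℕ → ℕ} {h x : ℕ} {v : Val} (hlo : 0 < lo)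
    (hr : Rep lo m h v x) : 0 < x ↔ v.NonZero := by
  cases v with
  | num n => cases hr; rfl
  | pair a b => simpa [Val.NonZero] using hlo.trans_le hr.1

/-- Case distinction on the first component of a pair. -/
def Program.cases (p q : Program) : Program :=
  .seq (.seq .open (.const 5 0)) (.ite 5 6 p q)

theorem exec_open_const (σ : State) : ∃ τ, Exec (.seq .open (.const 5 0)) σ 5 τ ∧
    τ.reg 1 = σ.mem (σ.reg 1 + 1) ∧ τ.reg 2 = σ.reg 2 ∧ τ.reg 3 = σ.reg 3 ∧
    τ.reg 5 = 0 ∧ τ.reg 6 = σ.mem (σ.reg 1) ∧ τ.mem = σ.mem := by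
  obtain ⟨σ₁, e₁, a1, a2, a3, a4, a5⟩ := exec_open σ
  refine ⟨_, .seq e₁ (.const ..), ?_⟩
  simp [State.setReg, *]

theorem Sim.cases_pos {p q : Program} {c v w : Val} {t : ℕ} (hc : c.NonZero) (h : Sim p v t w) :
    Sim (.cases p q) (.pair c v) (t + 6) w := by
  intro lo σ hlo h0 hr
  obtain ⟨σ₁, e₁, a1, a2, a3, a4, a5, a6⟩ := exec_open_const σ
  have hr₁ : Rep lo σ₁.mem (σ₁.reg 3) v (σ₁.reg 1) := by rw [a1, a3, a6]; exact hr.2.2.2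
  obtain ⟨τ, t', e, b1, b2, b3, b4, b5⟩ := h lo σ₁ hlo (by omega) hr₁
  have hlt : σ₁.reg 5 < σ₁.reg 6 := by rw [a4, a5]; exact (hr.2.2.1.pos_iff hlo).2 hc
  refine ⟨τ, _, .seq e₁ (.ite_true hlt e), by omega, by omega, fun a ha => ?_, ?_, b5⟩
  · rw [b3 a (by omega), a6]
  · rw [b4, a2]

theorem Sim.cases_neg {p q : Program} {c v w : Val} {t : ℕ} (hc : ¬ c.NonZero) (h : Sim q v t w) :
    Sim (.cases p q) (.pair c v) (t + 6) w := by
  intro lo σ hlo h0 hr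
  obtain ⟨σ₁, e₁, a1, a2, a3, a4, a5, a6⟩ := exec_open_const σ
  have hr₁ : Rep lo σ₁.mem (σ₁.reg 3) v (σ₁.reg 1) := by rw [a1, a3, a6]; exact hr.2.2.2
  obtain ⟨τ, t', e, b1, b2, b3, b4, b5⟩ := h lo σ₁ hlo (by omega) hr₁
  have hlt : ¬ σ₁.reg 5 < σ₁.reg 6 := by rw [a4, a5, hr.2.2.1.pos_iff hlo]; exact hc
  refine ⟨τ, _, .seq e₁ (.ite_false hlt e), by omega, by omega, fun a ha => ?_, ?_, b5⟩
  · rw [b3 a (by omega), a6]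
  · rw [b4, a2]

/-- The test of a loop. -/
def Program.test : Program := .seq (.load 6 1) (.const 5 0)

theorem exec_test (σ : State) : ∃ τ, Exec .test σ 2 τ ∧
    τ.reg 1 = σ.reg 1 ∧ τ.reg 2 = σ.reg 2 ∧ τ.reg 3 = σ.reg 3 ∧
    τ.reg 5 = 0 ∧ τ.reg 6 = σ.mem (σ.reg 1) ∧ τ.mem = σ.mem := by
  refine ⟨_, .seq (.load ..) (.const ..), ?_⟩
  simp [State.setReg]

/-- Repeat `p` while the first component of a pair is not `0`. -/
def Program.loop (p : Program) : Program := .seq .test (.while 5 6 (.seq p .test))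

theorem Sim.loop_neg {p : Program} {c v : Val} (hc : ¬ c.NonZero) :
    Sim (.loop p) (.pair c v) 3 (.pair c v) := by
  intro lo σ hlo h0 hr
  obtain ⟨σ₁, e₁, a1, a2, a3, a4, a5, a6⟩ := exec_test σ
  have hlt : ¬ σ₁.reg 5 < σ₁.reg 6 := by rw [a4, a5, hr.2.2.1.pos_iff hlo]; exact hc
  refine ⟨σ₁, _, .seq e₁ (.while_false hlt), le_rfl, by omega, fun a ha => by rw [a6], a2, ?_⟩
  rw [a1, a3, a6]; exact hr

theorem Sim.loop_pos {p : Program} {c v u w : Val} {s t : ℕ} (hc : c.NonZero)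
    (hp : Sim p (.pair c v) s u) (h : Sim (.loop p) u t w) :
    Sim (.loop p) (.pair c v) (s + t + 3) w := by
  intro lo σ hlo h0 hr
  obtain ⟨σ₁, e₁, a1, a2, a3, a4, a5, a6⟩ := exec_test σ
  have hlt : σ₁.reg 5 < σ₁.reg 6 := by rw [a4, a5]; exact (hr.2.2.1.pos_iff hlo).2 hc
  obtain ⟨σ₂, t₂, e₂, b1, b2, b3, b4, b5⟩ := hp lo σ₁ hlo (by omega) (by rw [a1, a3, a6]; exact hr)
  obtain ⟨τ, t', e, c1, c2, c3, c4, c5⟩ := h lo σ₂ hlo (by omega) b5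
  -- The run of the remaining loop starts with a `test`, which serves as the end of the loop body of
  -- the current round.
  cases e with | @seq _ _ _ σ' _ t u ea eb =>
  refine ⟨τ, _, .seq e₁ (.while_true hlt (.seq e₂ ea) eb), by omega, by omega,
    fun a ha => ?_, by rw [c4, b4, a2], c5⟩
  rw [c3 a (by omega), b3 a (by omega), a6]

end RAM

/-! ### Functions computed with a cost bound -/

namespace RAM

section Lists

variable {α β γ : Type}

/-- Case distinction on a list. -/
def lcase (l : List α) (z : β) (f : α → List α → β) : β :=
  match l with
  | [] => z
  | a :: t => f a t

@[simp] theorem lcase_nil (z : β) (f : α → List α → β) : lcase [] z f = z := rfl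

@[simp] theorem lcase_cons (a : α) (l : List α) (z : β) (f : α → List α → β) :
    lcase (a :: l) z f = f a l := rfl

/-- The number of steps of a loop with the body `step` of cost `g` over a list. -/
def foldCost (step : β → α → β) (g : β → α → ℕ) : List α → β → ℕ
  | [], _ => 0
  | a :: l, b => g b a + 1 + foldCost step g l (step b a)

/-- The invariant `I` is needed for bodies whose cost depends on the accumulator, for instance on
its length. -/
theorem foldCost_le {step : β → α → β} {g : β → α → ℕ} {c : ℕ} (I : β → Prop) {l : List α}
    (hI : ∀ b, ∀ a ∈ l, I b → I (step b a)) (hg : ∀ b, ∀ a ∈ l, I b → g b a ≤ c) {b : β}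
    (hb : I b) : foldCost step g l b ≤ l.length * (c + 1) := by
  induction l generalizing b with
  | nil => simp [foldCost]
  | cons a l ih =>
    have := ih (fun b a ha => hI b a (by simp [ha])) (fun b a ha => hg b a (by simp [ha]))
      (hI b a (by simp) hb)
    have := hg b a (by simp) hb
    simp only [foldCost, List.length_cons]
    nlinarith

theorem foldCost_le' {step : β → α → β} {g : β → α → ℕ} {c : ℕ} {l : List α} {b : β}
    (hg : ∀ b, ∀ a ∈ l, g b a ≤ c) : foldCost step g l b ≤ l.length * (c + 1) :=
  foldCost_le (fun _ => True) (fun _ _ _ _ => trivial) (fun b a ha _ => hg b a ha) trivial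

theorem foldCost_zero {step : β → α → β} {l : List α} {b : β} :
    foldCost step (fun _ _ => 0) l b = l.length := by
  induction l generalizing b with
  | nil => rfl
  | cons a l ih => simp [foldCost, ih, add_comm]

/-- The state carries the unread rest of the second list; once this is empty the state no longer
changes. -/
theorem foldl_lcase_zipWith (f : α → β → γ) (l : List α) (m : List β) (acc : List γ) :
    (l.foldl (fun s a => lcase s.1 s fun b t => (t, f a b :: s.2)) (m, acc)).2 =
      (List.zipWith f l m).reverse ++ acc := by
  induction l generalizing m acc with
  | nil => rfl
  | cons a l ih => cases m <;> simp [ih]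

end Lists

/-- Types whose elements are stored as binary trees of numbers. -/
class Enc (α : Type) where
  /-- The stored tree. -/
  enc : α → Val

open Enc

instance : Enc ℕ := ⟨.num⟩

instance {α β : Type} [Enc α] [Enc β] : Enc (α × β) := ⟨fun x => .pair (enc x.1) (enc x.2)⟩

/-- A list is stored as a linked list. -/
def encList {α : Type} [Enc α] : List α → Val
  | [] => .num 0
  | a :: l => .pair (enc a) (encList l)

instance {α : Type} [Enc α] : Enc (List α) := ⟨encList⟩

variable {X Y α β γ : Type} [Enc X] [Enc Y] [Enc α] [Enc β] [Enc γ]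

/-- Some program computes `f` within `O(g + 1)` steps. -/
def Run (f : α → β) (g : α → ℕ) : Prop :=
  ∃ (p : Program) (C : ℕ), ∀ a, Sim p (enc a) (C * (g a + 1)) (enc (f a))

/-- Some program computes `f` in constant time. -/
@[fun_prop]
def Fast (f : α → β) : Prop :=
  ∃ (p : Program) (C : ℕ), ∀ a, Sim p (enc a) C (enc (f a))

theorem Fast.run {f : α → β} (hf : Fast f) : Run f (fun _ => 0) := by
  obtain ⟨p, C, h⟩ := hf
  exact ⟨p, C, fun a => by simpa using h a⟩

theorem Run.fast {f : α → β} (hf : Run f (fun _ => 0)) : Fast f := by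
  obtain ⟨p, C, h⟩ := hf
  exact ⟨p, C, fun a => by simpa using h a⟩

theorem Run.mono {f : α → β} {g g' : α → ℕ} (hf : Run f g) (K : ℕ)
    (hg : ∀ a, g a ≤ K * (g' a + 1)) : Run f g' := by
  obtain ⟨p, C, h⟩ := hf
  refine ⟨p, C * (K + 1), fun a => (h a).mono ?_⟩
  rw [mul_assoc]
  refine Nat.mul_le_mul_left _ ?_
  nlinarith [hg a]

theorem Run.congr {f f' : α → β} {g : α → ℕ} (hf : Run f g) (h : ∀ a, f a = f' a) : Run f' g := by
  rwa [show f' = f from funext fun a => (h a).symm]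

theorem Run.of_le {f : α → β} {g g' : α → ℕ} (hf : Run f g) (hg : ∀ a, g a ≤ g' a) : Run f g' :=
  hf.mono 1 fun a => by linarith [hg a]

theorem Run.comp {f : β → γ} {h : α → β} {g : β → ℕ} {g' : α → ℕ} (hf : Run f g) (hh : Run h g') :
    Run (fun a => f (h a)) (fun a => g' a + g (h a)) := by
  obtain ⟨p, C, hp⟩ := hf
  obtain ⟨q, D, hq⟩ := hh
  refine ⟨.seq q p, C + D, fun a => ((hq a).seq (hp (h a))).mono ?_⟩
  nlinarith [Nat.zero_le (C * g' a), Nat.zero_le (D * g (h a))]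

theorem Run.comp_fast {f : β → γ} {h : α → β} {g : β → ℕ} (hf : Run f g) (hh : Fast h) :
    Run (fun a => f (h a)) (fun a => g (h a)) :=
  (hf.comp hh.run).of_le fun _ => by simp

theorem Fast.comp_run {f : β → γ} {h : α → β} {g : α → ℕ} (hf : Fast f) (hh : Run h g) :
    Run (fun a => f (h a)) g :=
  (hf.run.comp hh).of_le fun _ => by simp

theorem Run.prodMk {f : α → β} {f' : α → γ} {g g' : α → ℕ} (hf : Run f g) (hf' : Run f' g') :
    Run (fun a => (f a, f' a)) (fun a => g a + g' a) := by
  obtain ⟨p, C, hp⟩ := hf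
  obtain ⟨q, D, hq⟩ := hf'
  refine ⟨.both p q, C + D + 27, fun a => ((hp a).both (hq a)).mono ?_⟩
  nlinarith [Nat.zero_le (C * g' a), Nat.zero_le (D * g a)]

@[fun_prop]
theorem Fast.id : Fast (fun a : α => a) := ⟨_, _, fun _ => Sim.id _⟩

theorem exists_sim_const (w : Val) : ∃ (p : Program) (C : ℕ), ∀ v, Sim p v C w := by
  induction w with
  | num n => exact ⟨_, _, fun v => Sim.const n v⟩
  | pair a b iha ihb =>
    obtain ⟨p, C, hp⟩ := iha
    obtain ⟨q, D, hq⟩ := ihb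
    exact ⟨_, _, fun v => (hp v).both (hq v)⟩

@[fun_prop]
theorem Fast.const (b : β) : Fast (fun _ : α => b) := by
  obtain ⟨p, C, h⟩ := exists_sim_const (enc b)
  exact ⟨p, C, fun a => h _⟩

@[fun_prop]
theorem Fast.comp {f : β → γ} {h : α → β} (hf : Fast f) (hh : Fast h) : Fast (fun a => f (h a)) :=
  ((hf.run.comp hh.run).of_le fun _ => by simp).fast

@[fun_prop]
theorem Fast.prodMk {f : α → β} {f' : α → γ} (hf : Fast f) (hf' : Fast f') :
    Fast (fun a => (f a, f' a)) :=
  ((hf.run.prodMk hf'.run).of_le fun _ => by simp).fast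

theorem fast_fst : Fast (fun x : α × β => x.1) := ⟨_, _, fun _ => Sim.fst _ _⟩

theorem fast_snd : Fast (fun x : α × β => x.2) := ⟨_, _, fun _ => Sim.snd _ _⟩

@[fun_prop]
theorem Fast.fst {f : α → β × γ} (hf : Fast f) : Fast (fun a => (f a).1) := fast_fst.comp hf

@[fun_prop]
theorem Fast.snd {f : α → β × γ} (hf : Fast f) : Fast (fun a => (f a).2) := fast_snd.comp hf

@[fun_prop]
theorem Fast.add {f f' : α → ℕ} (hf : Fast f) (hf' : Fast f') : Fast (fun a => f a + f' a) :=
  Fast.comp (f := fun x : ℕ × ℕ => x.1 + x.2) ⟨_, _, fun _ => Sim.add _ _⟩ (hf.prodMk hf')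

@[fun_prop]
theorem Fast.sub {f f' : α → ℕ} (hf : Fast f) (hf' : Fast f') : Fast (fun a => f a - f' a) :=
  Fast.comp (f := fun x : ℕ × ℕ => x.1 - x.2) ⟨_, _, fun _ => Sim.sub _ _⟩ (hf.prodMk hf')

/-- Functions with the same stored results. -/
theorem Fast.of_enc {f : α → β} {f' : α → γ} (hf : Fast f) (h : ∀ a, enc (f a) = enc (f' a)) :
    Fast f' := by
  obtain ⟨p, C, hp⟩ := hf
  exact ⟨p, C, fun a => h a ▸ hp a⟩

@[fun_prop]
theorem Fast.cons {f : α → β} {f' : α → List β} (hf : Fast f) (hf' : Fast f') :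
    Fast (fun a => f a :: f' a) :=
  (hf.prodMk hf').of_enc fun _ => rfl

/-- Case distinction on whether a stored value is `0`. -/
theorem Run.cases {f : α × X → β} {f₁ : Y × X → β} {f₂ : X → β} {g : α × X → ℕ} {g₁ : Y × X → ℕ}
    {g₂ : X → ℕ} (h₁ : Run f₁ g₁) (h₂ : Run f₂ g₂)
    (h : ∀ a x, ((enc a).NonZero ∧ ∃ y : Y, enc a = enc y ∧ f (a, x) = f₁ (y, x) ∧
      g (a, x) = g₁ (y, x)) ∨ (¬ (enc a).NonZero ∧ f (a, x) = f₂ x ∧ g (a, x) = g₂ x)) :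
    Run f g := by
  obtain ⟨p, C, hp⟩ := h₁
  obtain ⟨q, D, hq⟩ := h₂.comp_fast (fast_snd (α := α))
  -- The tested value is duplicated because the case distinction consumes its first component.
  obtain ⟨r, E, hr⟩ : Fast fun z : α × X => (z.1, z) := by fun_prop
  refine ⟨.seq r (.cases p q), C + D + E + 6, fun ⟨a, x⟩ => ?_⟩
  refine Sim.seq (hr (a, x)) (t := (C + D) * (g (a, x) + 1) + 6) ?_ |>.mono (by nlinarith)
  rcases h a x with ⟨ha, y, hy, hf, hg⟩ | ⟨ha, hf, hg⟩
  · refine (Sim.cases_pos ha (t := C * (g (a, x) + 1)) ?_).mono (by nlinarith)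
    rw [hf, hg]
    have := hp (y, x)
    change Sim p (.pair (enc a) (enc x)) _ _
    rwa [hy]
  · refine (Sim.cases_neg ha (t := D * (g (a, x) + 1)) ?_).mono (by nlinarith)
    rw [hf, hg]
    exact hq (a, x)

/-- A nonempty list has the same stored form as the pair of its head and tail, so the nonzero branch
can reread it at the type `α × List α`. -/
theorem Run.lcase {l : X → List α} {z : X → β} {f : X → α → List α → β} {g₀ g₁ : X → ℕ}
    {g : X → α → List α → ℕ} (hl : Run l g₀) (hz : Run z g₁)
    (hf : Run (fun p : X × α × List α => f p.1 p.2.1 p.2.2) fun p => g p.1 p.2.1 p.2.2) :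
    Run (fun x => lcase (l x) (z x) (f x)) (fun x => g₀ x + lcase (l x) (g₁ x) (g x)) := by
  refine Run.comp (h := fun x => (l x, x)) (g' := g₀)
    (f := fun p : List α × X => RAM.lcase p.1 (z p.2) (f p.2))
    (g := fun p : List α × X => RAM.lcase p.1 (g₁ p.2) (g p.2)) ?_
    ((hl.prodMk Fast.id.run).of_le fun _ => by simp)
  refine Run.cases (Y := α × List α)
    (hf.comp_fast (h := fun p : (α × List α) × X => (p.2, p.1.1, p.1.2)) (by fun_prop)) hz ?_
  rintro (_ | ⟨a, t⟩) x
  · exact Or.inr ⟨lt_irrefl 0, rfl, rfl⟩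
  · exact Or.inl ⟨trivial, (a, t), rfl, rfl, rfl⟩

theorem Fast.lcase {l : X → List α} {z : X → β} {f : X → α → List α → β}
    (hl : Fast l) (hz : Fast z) (hf : Fast (fun p : X × α × List α => f p.1 p.2.1 p.2.2)) :
    Fast (fun x => RAM.lcase (l x) (z x) (f x)) :=
  ((hl.run.lcase hz.run (g := fun _ _ _ => 0) hf.run).of_le fun x => by cases l x <;> simp).fast

/-- `a < b` means that the truncated difference `b - a` is not `0`, which reduces comparisons to the
zero test. -/
theorem Run.ite {a b : X → ℕ} {f f' : X → β} {g g' : X → ℕ}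
    (ha : Fast a) (hb : Fast b) (hf : Run f g) (hf' : Run f' g') :
    Run (fun x => if a x < b x then f x else f' x) (fun x => if a x < b x then g x else g' x) := by
  refine (((Run.cases (α := ℕ) (X := X) (Y := ℕ)
    (f := fun p => if 0 < p.1 then f p.2 else f' p.2)
    (g := fun p => if 0 < p.1 then g p.2 else g' p.2)
    (hf.comp_fast fast_snd) hf' ?_).comp_fast (h := fun x => (b x - a x, x)) (by fun_prop)).congr
    (f' := fun x => if a x < b x then f x else f' x) ?_).of_le ?_
  · intro n x
    rcases Nat.eq_zero_or_pos n with rfl | h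
    · exact Or.inr ⟨lt_irrefl 0, rfl, rfl⟩
    · exact Or.inl ⟨h, n, rfl, if_pos h, if_pos h⟩
  · intro x
    simp
  · intro x
    simp

@[fun_prop]
theorem Fast.ite {a b : X → ℕ} {f f' : X → β} (ha : Fast a) (hb : Fast b) (hf : Fast f)
    (hf' : Fast f') : Fast (fun x => if a x < b x then f x else f' x) :=
  ((Run.ite ha hb hf.run hf'.run).of_le fun x => by simp).fast

/-- The loop works on the triple of unread list, parameter and accumulator. The empty list is stored
as `0`, so the loop test on the first component is the test for the end of the list. -/
theorem Run.foldl {l : X → List α} {b : X → β} {step : X → β → α → β} {g₀ g₁ : X → ℕ}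
    {g : X → β → α → ℕ} (hl : Run l g₀) (hb : Run b g₁)
    (hs : Run (fun p : X × β × α => step p.1 p.2.1 p.2.2) fun p => g p.1 p.2.1 p.2.2) :
    Run (fun x => (l x).foldl (step x) (b x))
      (fun x => g₀ x + g₁ x + foldCost (step x) (g x) (l x) (b x)) := by
  have key : Run (fun p : List α × X × β => p.1.foldl (step p.2.1) p.2.2)
      (fun p => foldCost (step p.2.1) (g p.2.1) p.1 p.2.2) := by
    have h1 : Run (fun p : (α × List α) × X × β => (p.1.2, p.2.1, step p.2.1 p.2.2 p.1.1))
        (fun p => g p.2.1 p.2.2 p.1.1) :=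
      (Run.prodMk (Fast.run (by fun_prop)) (Run.prodMk (Fast.run (by fun_prop)) (hs.comp_fast
        (h := fun p : (α × List α) × X × β => (p.2.1, p.2.2, p.1.1)) (by fun_prop)))).of_le
        fun _ => by simp
    obtain ⟨p, C, hp⟩ := h1
    have h2 : ∀ (l : List α) (x : X) (b : β), Sim (.loop p) (enc (l, x, b))
        ((C + 3) * (foldCost (step x) (g x) l b + 1))
        (enc (([] : List α), x, l.foldl (step x) b)) := by
      intro l
      induction l with
      | nil =>
        intro x b
        exact (Sim.loop_neg (c := .num 0) (lt_irrefl 0)).mono (by simp [foldCost])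
      | cons a l ih =>
        intro x b
        refine (Sim.loop_pos (c := enc (a :: l)) trivial (hp ((a, l), x, b)) (ih x _)).mono ?_
        simp only [foldCost]
        nlinarith
    obtain ⟨q, D, hq⟩ : Fast fun p : List α × X × β => p.2.2 := by fun_prop
    refine ⟨.seq (.loop p) q, C + 3 + D, fun ⟨l, x, b⟩ => ((h2 l x b).seq (hq _)).mono ?_⟩
    simp only
    nlinarith
  exact (key.comp (hl.prodMk (Fast.id.run.prodMk hb))).of_le fun x => by simp

/-- A loop over a list whose body takes constant time. -/
theorem Run.foldl_fast {l : X → List α} {b : X → β} {step : X → β → α → β} {g₀ : X → ℕ}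
    (hl : Run l g₀) (hb : Fast b) (hs : Fast fun p : X × β × α => step p.1 p.2.1 p.2.2) :
    Run (fun x => (l x).foldl (step x) (b x)) (fun x => g₀ x + (l x).length) :=
  (hl.foldl hb.run (g := fun _ _ _ => 0) hs.run).of_le fun x => by simp [foldCost_zero]

theorem Run.reverse {l : X → List α} {g : X → ℕ} (hl : Run l g) :
    Run (fun x => (l x).reverse) (fun x => g x + (l x).length) := by
  refine (hl.foldl_fast (b := fun _ => []) (step := fun _ b a => a :: b) (by fun_prop)
    (by fun_prop)).congr fun x => ?_
  simp

theorem Run.map {l : X → List α} {f : X → α → β} {g : X → ℕ} (hl : Run l g)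
    (hf : Fast fun p : X × α => f p.1 p.2) :
    Run (fun x => (l x).map (f x)) (fun x => g x + (l x).length) := by
  refine (((hl.foldl_fast (b := fun _ => []) (step := fun x b a => f x a :: b) (by fun_prop)
    ?_).reverse.congr fun x => ?_)).mono 2 fun x => ?_
  · exact (Fast.comp (f := fun p : X × α => f p.1 p.2) hf
      (h := fun p : X × List β × α => (p.1, p.2.2)) (by fun_prop)).cons (by fun_prop)
  · simp
  · simp
    omega

theorem Run.foldr {l : X → List α} {b : X → β} {step : X → α → β → β} {g₀ g₁ : X → ℕ}
    {g : X → α → β → ℕ} (hl : Run l g₀) (hb : Run b g₁)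
    (hs : Run (fun p : X × α × β => step p.1 p.2.1 p.2.2) fun p => g p.1 p.2.1 p.2.2) :
    Run (fun x => (l x).foldr (step x) (b x))
      (fun x => g₀ x + g₁ x + (l x).length +
        foldCost (fun b a => step x a b) (fun b a => g x a b) (l x).reverse (b x)) := by
  refine ((hl.reverse.foldl hb (step := fun x b a => step x a b) (g := fun x b a => g x a b)
    (hs.comp_fast (h := fun p : X × β × α => (p.1, p.2.2, p.2.1)) (by fun_prop))).congr
    fun x => ?_).of_le fun x => ?_
  · simp
  · omega

theorem Run.zipWith {l : X → List α} {m : X → List β} {f : X → α → β → γ} {g g' : X → ℕ}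
    (hl : Run l g) (hm : Run m g') (hf : Fast fun p : X × α × β => f p.1 p.2.1 p.2.2) :
    Run (fun x => List.zipWith (f x) (l x) (m x)) (fun x => g x + g' x + (l x).length) := by
  refine (((fast_snd.comp_run (hl.foldl (b := fun x => (m x, []))
    (step := fun x s a => RAM.lcase s.1 s fun b t => (t, f x a b :: s.2)) (g := fun _ _ _ => 0)
    (((hm.prodMk (Fast.run (by fun_prop)))).of_le (g' := g') fun _ => by simp)
    (Fast.run ?_))).reverse.congr fun x => ?_)).mono 2 fun x => ?_
  · refine Fast.lcase (by fun_prop) (by fun_prop) (Fast.prodMk (by fun_prop)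
      (Fast.cons (Fast.comp (f := fun p : X × α × β => f p.1 p.2.1 p.2.2) hf
      (h := fun p : (X × (List β × List γ) × α) × β × List β => (p.1.1, p.1.2.2, p.2.1))
      (by fun_prop)) (by fun_prop)))
  · rw [foldl_lcase_zipWith]; simp
  · rw [foldl_lcase_zipWith]; simp [foldCost_zero]
    omega

/-- The loop counts down, so that prepending yields the numbers in increasing order. -/
theorem run_range : Run List.range fun n => n := by
  obtain ⟨p, C, hp⟩ : Fast fun s : ℕ × List ℕ => (s.1 - 1, (s.1 - 1) :: s.2) := by fun_prop
  have h : ∀ n l, Sim (.loop p) (enc ((n, l) : ℕ × List ℕ)) ((C + 3) * (n + 1))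
      (enc ((0, List.range n ++ l) : ℕ × List ℕ)) := by
    intro n
    induction n with
    | zero => exact fun l => (Sim.loop_neg (c := .num 0) (lt_irrefl 0)).mono (by simp)
    | succ n ih =>
      intro l
      rw [List.range_succ, List.append_assoc]
      exact (Sim.loop_pos (c := enc (n + 1)) n.succ_pos (hp (n + 1, l)) (ih (n :: l))).mono
        (by nlinarith)
  have h' : Run (fun s : ℕ × List ℕ => (0, List.range s.1 ++ s.2)) (fun s => s.1) :=
    ⟨_, _, fun s => h s.1 s.2⟩
  exact (fast_snd.comp_run (h'.comp_fast (h := fun n => (n, [])) (by fun_prop))).congr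
    fun n => by simp

end RAM

/-! ### Input and output -/

namespace RAM

open Enc

/-- Store the input as a linked list. -/
def Program.read : Program :=
  .seq (.const 9 1) <| .seq (.copy 7 0) <| .seq (.add 3 0 9) <|
    .while 8 7 (.seq (.sub 7 7 9) (.seq (.load 6 7) .alloc))

/-- The cells are read from the last to the first, so prepending restores the order; `l₁` is the
unread prefix. Register `7` counts the unread cells and the registers `8` and `9` hold the constants
`0` and `1`; allocation does not touch them. -/
theorem exec_read_loop (input : List ℕ) (l₁ l₂ : List ℕ) (h : input = l₁ ++ l₂) (σ : State)
    (h2 : σ.reg 2 = 0) (h3 : input.length < σ.reg 3)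
    (h7 : σ.reg 7 = l₁.length) (h8 : σ.reg 8 = 0) (h9 : σ.reg 9 = 1)
    (hm : ∀ a < input.length, σ.mem a = input.getD a 0)
    (hr : Rep (input.length + 1) σ.mem (σ.reg 3) (enc l₂) (σ.reg 1)) :
    ∃ τ, Exec (.while 8 7 (.seq (.sub 7 7 9) (.seq (.load 6 7) .alloc))) σ (9 * l₁.length + 1) τ ∧
      input.length < τ.reg 3 ∧ Rep (input.length + 1) τ.mem (τ.reg 3) (enc input) (τ.reg 1) := by
  induction l₁ using List.reverseRecOn generalizing l₂ σ with
  | nil =>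
    subst h
    exact ⟨σ, .while_false (by simp [h7, h8]), h3, hr⟩
  | append_singleton l₁ a ih =>
    let σ₁ := σ.setReg 7 (σ.reg 7 - σ.reg 9)
    let σ₂ := σ₁.setReg 6 (σ₁.mem (σ₁.reg 7))
    have e₁ : Exec (.sub 7 7 9) σ 1 σ₁ := .sub ..
    have e₂ : Exec (.load 6 7) σ₁ 1 σ₂ := .load ..
    obtain ⟨σ₃, e₃, a1, a2, a3, a4, a5, a6, a7⟩ := exec_alloc σ₂
    simp only [σ₂, σ₁, State.setReg, Function.update_apply] at a1 a2 a3 a4 a5 a6 a7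
    simp [h9, h7] at a1 a2 a3 a4 a5 a6 a7
    have hlen : input.length = l₁.length + 1 + l₂.length := by simp [h]; omega
    rw [hm _ (by omega)] at a4
    have hr' : Rep (input.length + 1) σ₃.mem (σ₃.reg 3) (enc (a :: l₂)) (σ₃.reg 1) := by
      rw [a1]
      refine ⟨by omega, by omega, ?_, ?_⟩
      · rw [a4, h]
        simp [enc, Rep]
      · rw [a5]
        exact hr.mono a6 (by omega)
    obtain ⟨τ, e, b1, b2⟩ := ih (a :: l₂) (by simp [h]) σ₃ (by omega) (by omega)
      (by simp [a7 7]) (by simp [a7 8, h8]) (by simp [a7 9, h9])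
      (fun b hb => by rw [a6 b (by omega), hm b hb]) hr'
    refine ⟨τ, ?_, b1, b2⟩
    refine (Exec.while_true (by simp [h7, h8]) (.seq e₁ (.seq e₂ e₃)) e).of_eq ?_
    simp
    ring

theorem exec_read (input : List ℕ) : ∃ τ, Exec .read (init input) (9 * input.length + 4) τ ∧
    input.length < τ.reg 3 ∧ Rep (input.length + 1) τ.mem (τ.reg 3) (enc input) (τ.reg 1) := by
  obtain ⟨τ, e, h⟩ := exec_read_loop input input [] (by simp)
    ((((init input).setReg 9 1).setReg 7 input.length).setReg 3 (input.length + 1))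
    (by simp [State.setReg, init]) (by simp [State.setReg])
    (by simp [State.setReg]) (by simp [State.setReg, init]) (by simp [State.setReg])
    (fun a _ => by simp [State.setReg, init]) (by simp [State.setReg, init, enc, encList, Rep])
  refine ⟨τ, ?_, h⟩
  exact (Exec.seq (.const 9 1 (init input)) <| .seq (.copy 7 0 _) <|
    .seq (.add 3 0 9 _) e).of_eq (by ring)

/-- Write a linked list to the cells `0, 1, …`. -/
def Program.write : Program :=
  .seq (.const 0 0) <| .seq (.const 4 1) <| .seq (.const 5 0) <|
    .while 5 1 (.seq (.load 6 1) <| .seq (.store 0 6) <| .seq (.add 0 0 4) <|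
      .seq (.add 1 1 4) (.load 1 1))

/-- Only cells below `lo` are written, whereas the list lives at `lo` and above; hence its unread
part `l₂` stays represented. -/
theorem exec_write_loop {lo h : ℕ} (l₂ l₁ : List ℕ) (σ : State)
    (hlo : l₁.length + l₂.length < lo) (h4 : σ.reg 4 = 1) (h5 : σ.reg 5 = 0)
    (h0 : σ.reg 0 = l₁.length) (hl : output σ = l₁)
    (hr : Rep lo σ.mem h (enc l₂) (σ.reg 1)) :
    ∃ τ, Exec (.while 5 1 (.seq (.load 6 1) <| .seq (.store 0 6) <| .seq (.add 0 0 4) <|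
      .seq (.add 1 1 4) (.load 1 1))) σ (6 * l₂.length + 1) τ ∧ output τ = l₁ ++ l₂ := by
  induction l₂ generalizing l₁ σ with
  | nil =>
    refine ⟨σ, .while_false ?_, by simpa using hl⟩
    rw [h5, show σ.reg 1 = 0 from hr]
    exact lt_irrefl 0
  | cons a l₂ ih =>
    obtain ⟨hx, hxh, ha, ht⟩ := hr
    rw [List.length_cons] at hlo
    let σ₁ := σ.setReg 6 (σ.mem (σ.reg 1))
    let σ₂ := σ₁.setMem (σ₁.reg 0) (σ₁.reg 6)
    let σ₃ := σ₂.setReg 0 (σ₂.reg 0 + σ₂.reg 4)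
    let σ₄ := σ₃.setReg 1 (σ₃.reg 1 + σ₃.reg 4)
    let σ₅ := σ₄.setReg 1 (σ₄.mem (σ₄.reg 1))
    have e : Exec (.seq (.load 6 1) <| .seq (.store 0 6) <| .seq (.add 0 0 4) <|
      .seq (.add 1 1 4) (.load 1 1)) σ _ σ₅ := .seq (.load ..) <| .seq (.store ..) <|
        .seq (.add ..) <| .seq (.add ..) (.load ..)
    have hmem : σ₅.mem = Function.update σ.mem l₁.length a := by
      have : σ.mem (σ.reg 1) = a := ha
      simp [σ₅, σ₄, σ₃, σ₂, σ₁, State.setReg, State.setMem, h0, this]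
    have h0' : σ₅.reg 0 = l₁.length + 1 := by
      simp [σ₅, σ₄, σ₃, σ₂, σ₁, State.setReg, State.setMem, h0, h4]
    have h1' : σ₅.reg 1 = σ.mem (σ.reg 1 + 1) := by
      simp only [σ₅, σ₄, σ₃, σ₂, σ₁, State.setReg, State.setMem, Function.update_apply, h0, h4]
      simp
      intro; omega
    have hl' : output σ₅ = l₁ ++ [a] := by
      rw [output, h0', List.range_succ, List.map_append, hmem]
      congr 1
      · conv_rhs => rw [← hl, output, h0]
        refine List.map_congr_left fun b hb => ?_
        have := List.mem_range.1 hb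
        exact Function.update_of_ne (by omega) _ _
      · simp
    have hr' : Rep lo σ₅.mem h (enc l₂) (σ₅.reg 1) := by
      rw [h1']
      refine Rep.congr (fun b hb _ => ?_) le_rfl ht
      rw [hmem]
      exact Function.update_of_ne (by omega) _ _
    obtain ⟨τ, e', h'⟩ := ih (l₁ ++ [a]) σ₅ (by simp; omega)
      (by simp [σ₅, σ₄, σ₃, σ₂, σ₁, State.setReg, State.setMem, h4])
      (by simp [σ₅, σ₄, σ₃, σ₂, σ₁, State.setReg, State.setMem, h5])
      (by simp [h0']) hl' hr'
    refine ⟨τ, (Exec.while_true (by omega) e e').of_eq (by simp; ring), by simpa using h'⟩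

theorem exec_write {lo : ℕ} (l : List ℕ) (σ : State) (hlo : l.length < lo)
    (hr : Rep lo σ.mem (σ.reg 3) (enc l) (σ.reg 1)) :
    ∃ τ, Exec .write σ (6 * l.length + 4) τ ∧ output τ = l := by
  obtain ⟨τ, e, h⟩ := exec_write_loop (lo := lo) (h := σ.reg 3) l []
    (((σ.setReg 0 0).setReg 4 1).setReg 5 0) (by simpa using hlo)
    (by simp [State.setReg]) (by simp [State.setReg]) (by simp [State.setReg])
    (by simp [State.setReg, output]) (by simpa [State.setReg] using hr)
  refine ⟨τ, ?_, h⟩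
  exact (Exec.seq (.const 0 0 σ) <| .seq (.const 4 1 _) <| .seq (.const 5 0 _) e).of_eq (by ring)

/-- The heap starts right after the input area, at `input.length + 1`. The length condition makes
the output fit below it. -/
theorem Run.computes {f : List ℕ → List ℕ} {g : List ℕ → ℕ} (hf : Run f g) :
    ∃ (p : Program) (C : ℕ), ∀ input, (f input).length ≤ input.length →
      ∃ t, Computes p input (f input) t ∧ t ≤ C * (g input + input.length + 1) := by
  obtain ⟨p, C, hp⟩ := hf
  refine ⟨.seq .read (.seq p .write), C + 15, fun input hlen => ?_⟩
  obtain ⟨σ, e₁, h3, hr⟩ := exec_read input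
  obtain ⟨τ, t, e₂, ht, -, -, -, hr'⟩ := hp input _ σ (Nat.succ_pos _) h3 hr
  obtain ⟨ρ, e₃, ho⟩ := exec_write (f input) τ (by omega) hr'
  refine ⟨_, ⟨ρ, .seq e₁ (.seq e₂ e₃), ho⟩, ?_⟩
  nlinarith [Nat.zero_le (C * input.length)]

end RAM

/-! ### The dynamic program -/

/-- A compressed description of vertex sets: a set for a substitution consists of the sets for its
parts, and `cons b c k r` describes the part `k` followed by the remaining parts `r`, where `k`
receives `b` extra vertices and can receive up to `c` more. -/
inductive Sol where
  | nil : Sol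
  | leaf (v : ℕ) : Sol
  | cons (b c : ℕ) (k r : Sol) : Sol

namespace Sol

/-- The described vertex set with `e` extra vertices. -/
def emit : Sol → ℕ → List ℕ
  | nil, _ => []
  | leaf v, e => if 0 < e then [v] else []
  -- Truncated subtraction makes `e - (e - c)` the minimum of `e` and `c`: the part `k` is filled
  -- first, and `e - c` extra vertices remain for `r`.
  | cons b c k r, e => k.emit (b + (e - (e - c))) ++ r.emit (e - c)

/-- The number of constructors. -/
def size : Sol → ℕ
  | nil => 1
  | leaf _ => 1
  | cons _ _ k r => k.size + r.size + 1

/-- Case distinction. -/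
def elim {β : Type} (s : Sol) (z : β) (f : ℕ → β) (g : ℕ → ℕ → Sol → Sol → β) : β :=
  match s with
  | nil => z
  | leaf v => f v
  | cons b c k r => g b c k r

/-- One step of the evaluation of `Sol.emit` with a stack. -/
def step (σ : List (Sol × ℕ) × List ℕ) : List (Sol × ℕ) × List ℕ :=
  RAM.lcase σ.1 σ fun p t => p.1.elim (t, σ.2) (fun v => if 0 < p.2 then (t, v :: σ.2) else (t, σ.2))
    fun b c k r => ((k, b + (p.2 - (p.2 - c))) :: (r, p.2 - c) :: t, σ.2)

end Sol

namespace ModularDP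

open RAM

/-- The table of a graph: its number of vertices, and for every demand the size and a description of
a smallest set that satisfies the demand. -/
abbrev Tab := ℕ × List (ℕ × Sol)

/-- The table of a single vertex, for the demands `D`. -/
def leafTab (D : List ℕ) (v : ℕ) : Tab :=
  (1, D.map fun r => if 0 < r then (1, .cons 1 0 (.leaf v) .nil) else (0, .leaf v))

/-- Decrease the demands by one. -/
def shift (g : List (ℕ × Sol)) : List (ℕ × Sol) := lcase g [] fun x t => x :: x :: t

/-- Decrease the demands in the parts that are marked in `row`. -/
def shiftRow (row : List ℕ) (gs : List (List (ℕ × Sol))) : List (List (ℕ × Sol)) :=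
  List.zipWith (fun b g => if 0 < b then shift g else g) row gs

/-- A choice of (truncated) sizes for some of the parts, with the tables of all parts for the
demands that remain. -/
abbrev Node := List (List (ℕ × Sol)) × List ℕ

/-- Choose the size of one more part. -/
def expand (D row : List ℕ) (z : ℕ) (nd : Node) (acc : List Node) : List Node :=
  (D.foldl (fun p v => (shiftRow row p.1, if z < v then p.2 else (p.1, v :: nd.2) :: p.2))
    (nd.1, acc)).2

/-- Choose the size of one more part in all given choices. -/
def level (D : List ℕ) (rz : List ℕ × ℕ) (ns : List Node) : List Node :=
  ns.foldl (fun acc nd => expand D rz.1 rz.2 nd acc) []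

/-- All choices of sizes of parts. -/
def nodes (D : List ℕ) (rzs : List (List ℕ × ℕ)) (gs : List (List (ℕ × Sol))) : List Node :=
  rzs.foldr (level D) [(gs, [])]

/-- Add a part with `z` vertices, of which at least `s` are chosen. -/
def addPart (z s : ℕ) (a x : ℕ × Sol) : ℕ × Sol :=
  (a.1 + (x.1 + (s - x.1)), .cons (s - x.1) (z - (x.1 + (s - x.1))) x.2 a.2)

/-- The solutions for a choice of sizes of the parts. -/
def eval (D : List ℕ) (items : List (ℕ × List (ℕ × Sol) × ℕ)) : List (ℕ × Sol) :=
  items.foldr (fun it acc => List.zipWith (addPart it.1 it.2.2) acc it.2.1)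
    (D.map fun _ => (0, .nil))

/-- The better one of two solutions, for every demand. -/
def merge (best es : List (ℕ × Sol)) : List (ℕ × Sol) :=
  lcase best es fun _ _ => List.zipWith (fun a x => if x.1 < a.1 then x else a) best es

/-- The table of a substitution into the outline graph with the given adjacency matrix. -/
def comb (D : List ℕ) (kids : List Tab) (rows : List (List ℕ)) : Tab :=
  ((kids.map Prod.fst).foldl (· + ·) 0,
    (nodes D (List.zipWith Prod.mk rows (kids.map Prod.fst)) (kids.map Prod.snd)).foldl
      (fun best nd => merge best (eval D
        (List.zipWith (fun p s => (p.1, p.2, s))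
          (List.zipWith Prod.mk (kids.map Prod.fst) nd.1) nd.2))) [])

/-- Split off the first `n` elements of a list, in reverse order. -/
def splitRev {α : Type} (n : ℕ) (l : List α) : List α × List α :=
  (List.range n).foldl (fun p _ => lcase p.2 p fun a t => (a :: p.1, t)) ([], l)

/-- Split off a square matrix, with the rows in reverse order. -/
def readRows (n : ℕ) (l : List ℕ) : List (List ℕ) × List ℕ :=
  (List.range n).foldl (fun p _ => ((splitRev n p.2).1.reverse :: p.1, (splitRev n p.2).2)) ([], l)

/-- Replace the topmost `n` tables of the stack by the one of a substitution. -/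
def reduce (D : List ℕ) (n : ℕ) (rows : List (List ℕ)) (stack : List Tab) : List Tab :=
  comb D (splitRev n stack).1 rows :: (splitRev n stack).2

/-- Process one symbol of a parse tree. -/
def parseStep (D : List ℕ) (st : List Tab × List ℕ) : List Tab × List ℕ :=
  lcase st.2 st fun c l =>
    if c < 1 then lcase l st fun v l' => (leafTab D v :: st.1, l')
    else if c < 2 then (reduce D 2 [[0, 0], [0, 0]] st.1, l)
    else if c < 3 then (reduce D 2 [[0, 1], [1, 0]] st.1, l)
    else lcase l st fun n l' => (reduce D n (readRows n l').1.reverse st.1, (readRows n l').2)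

/-- The table of the graph of a parse tree. -/
def parse (D code : List ℕ) : List Tab × List ℕ :=
  code.foldl (fun st _ => parseStep D st) ([], code)

/-- The list of the vertices described by a solution. -/
def emitAll (fuel : List ℕ) (s : Sol) : List ℕ :=
  (fuel.foldl (fun σ _ => Sol.step (Sol.step (Sol.step σ))) ([(s, 0)], [])).2

/-- The solution for the largest demand in the topmost table of a stack. -/
def final (stack : List Tab) : Sol :=
  (lcase stack (0, Sol.nil) fun t _ => t.2.foldl (fun _ e => e) (0, Sol.nil)).2

/-- The algorithm. -/
def solve (input : List ℕ) : List ℕ :=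
  lcase input [] fun d code => emitAll code (final (parse (List.range (d + 1)) code).1)

/-! ### Costs -/

/-- Cost of `level`. -/
def levelCost (D : List ℕ) (rz : List ℕ × ℕ) (ns : List Node) : ℕ :=
  ns.length * (D.length * (rz.1.length + 1) + 1)

/-- Cost of `nodes`. -/
def nodesCost (D : List ℕ) (rzs : List (List ℕ × ℕ)) (gs : List (List (ℕ × Sol))) : ℕ :=
  rzs.length +
    foldCost (fun ns rz => level D rz ns) (fun ns rz => levelCost D rz ns) rzs.reverse [(gs, [])]

/-- Cost of `comb`. -/
def combCost (D : List ℕ) (kids : List Tab) (rows : List (List ℕ)) : ℕ :=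
  kids.length + rows.length +
    nodesCost D (List.zipWith Prod.mk rows (kids.map Prod.fst)) (kids.map Prod.snd) +
    (nodes D (List.zipWith Prod.mk rows (kids.map Prod.fst)) (kids.map Prod.snd)).length *
      ((kids.length + 1) * (D.length + 1))

/-- Cost of `reduce`. -/
def reduceCost (D : List ℕ) (n : ℕ) (rows : List (List ℕ)) (stack : List Tab) : ℕ :=
  n + combCost D (splitRev n stack).1 rows

/-- Cost of `parseStep`. -/
def parseStepCost (D : List ℕ) (st : List Tab × List ℕ) : ℕ :=
  lcase st.2 0 fun c l =>
    if c < 1 then lcase l 0 fun _ _ => D.length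
    else if c < 2 then reduceCost D 2 [[0, 0], [0, 0]] st.1
    else if c < 3 then reduceCost D 2 [[0, 1], [1, 0]] st.1
    else lcase l 0 fun n l' => n * (n + 1) + reduceCost D n (readRows n l').1.reverse st.1

/-- Cost of `solve`. -/
def solveCost (input : List ℕ) : ℕ :=
  lcase input 0 fun d code => d + code.length +
    foldCost (fun st _ => parseStep (List.range (d + 1)) st)
      (fun st _ => parseStepCost (List.range (d + 1)) st) code ([], code) +
    lcase (parse (List.range (d + 1)) code).1 0 fun t _ => t.2.length

end ModularDP

/-! ### Programs for the functions of the dynamic program -/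

namespace RAM

open Enc Sol ModularDP

/-- The stored form of a description. -/
def encSol : Sol → Val
  | .nil => .num 0
  | .leaf v => .pair (.num 0) (.num v)
  | .cons b c k r => .pair (.pair (.num b) (.num c)) (.pair (encSol k) (encSol r))

instance : Enc Sol := ⟨encSol⟩

variable {X : Type} [Enc X]

@[fun_prop]
theorem Fast.solLeaf {f : X → ℕ} (hf : Fast f) : Fast fun x => Sol.leaf (f x) :=
  (show Fast fun x => (0, f x) by fun_prop).of_enc fun _ => rfl

@[fun_prop]
theorem Fast.solCons {f g : X → ℕ} {k r : X → Sol} (hf : Fast f) (hg : Fast g) (hk : Fast k)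
    (hr : Fast r) : Fast fun x => Sol.cons (f x) (g x) (k x) (r x) :=
  (show Fast fun x => ((f x, g x), (k x, r x)) by fun_prop).of_enc fun _ => rfl

/-- Two zero tests identify the constructor: `nil` is stored as `0`, `leaf` as a pair with first
component `0`, and `cons` as a pair whose first component is again a pair. -/
theorem Fast.solElim {β : Type} [Enc β] {s : X → Sol} {z : X → β} {f : X → ℕ → β}
    {g : X → ℕ → ℕ → Sol → Sol → β} (hs : Fast s) (hz : Fast z)
    (hf : Fast fun p : X × ℕ => f p.1 p.2)
    (hg : Fast fun p : X × ℕ × ℕ × Sol × Sol => g p.1 p.2.1 p.2.2.1 p.2.2.2.1 p.2.2.2.2) :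
    Fast fun x => (s x).elim (z x) (f x) (g x) := by
  obtain ⟨p, C, hp⟩ := hz.comp (fast_snd (α := Sol))
  obtain ⟨q, D, hq⟩ := hf.comp (h := fun y : (ℕ × ℕ) × X => (y.2, y.1.2)) (by fun_prop)
  obtain ⟨r, E, hr⟩ := hg.comp (h := fun y : ((ℕ × ℕ) × (Sol × Sol)) × X =>
    (y.2, y.1.1.1, y.1.1.2, y.1.2.1, y.1.2.2)) (by fun_prop)
  have key : Fast fun y : Sol × X => y.1.elim (z y.2) (f y.2) (g y.2) := by
    refine ⟨.seq (.both (.load 1 1) (.copy 1 1)) (.cases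
      (.seq (.both (.seq (.load 1 1) (.load 1 1)) (.copy 1 1)) (.cases r q)) p),
      C + D + E + 100, fun ⟨s, x⟩ => ?_⟩
    refine Sim.mono (Sim.seq ((Sim.fst _ _).both (Sim.id _)) (t := C + D + E + 60) ?_) (by omega)
    refine Sim.mono (t := C + D + E + 50 + 6) ?_ (by omega)
    cases s with
    | nil => exact Sim.cases_neg (lt_irrefl 0) ((hp (.nil, x)).mono (by omega))
    | leaf v =>
      refine Sim.cases_pos trivial (.mono
        (Sim.seq (((Sim.fst _ _).seq (Sim.fst _ _)).both (Sim.id _)) (t := D + 6) ?_) (by omega))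
      exact Sim.cases_neg (lt_irrefl 0) (hq ((0, v), x))
    | cons b c k r =>
      refine Sim.cases_pos trivial (.mono
        (Sim.seq (((Sim.fst _ _).seq (Sim.fst _ _)).both (Sim.id _)) (t := E + 6) ?_) (by omega))
      exact Sim.cases_pos trivial (hr (((b, c), (k, r)), x))
  exact key.comp (hs.prodMk Fast.id)

theorem fast_solStep : Fast Sol.step := by
  refine Fast.lcase (by fun_prop) (by fun_prop) (Fast.solElim (by fun_prop) (by fun_prop) ?_ ?_)
  · fun_prop
  · fun_prop

@[fun_prop]
theorem Fast.shift {g : X → List (ℕ × Sol)} (hg : Fast g) : Fast fun x => shift (g x) :=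
  Fast.lcase hg (by fun_prop) (by fun_prop)

theorem run_shiftRow {row : X → List ℕ} {gs : X → List (List (ℕ × Sol))} (hr : Fast row)
    (hg : Fast gs) : Run (fun x => shiftRow (row x) (gs x)) fun x => (row x).length :=
  (Run.zipWith hr.run hg.run (f := fun _ b g => if 0 < b then ModularDP.shift g else g)
    (by fun_prop)).of_le fun x => by simp

theorem run_expand {D row : X → List ℕ} {z : X → ℕ} {nd : X → Node} {acc : X → List Node}
    (hD : Fast D) (hrow : Fast row) (hz : Fast z) (hnd : Fast nd) (hacc : Fast acc) :
    Run (fun x => expand (D x) (row x) (z x) (nd x) (acc x))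
      fun x => (D x).length * ((row x).length + 1) := by
  refine (fast_snd.comp_run (Run.foldl hD.run (b := fun x => ((nd x).1, acc x))
    (Fast.run (by fun_prop)) (step := fun x p v => (shiftRow (row x) p.1,
      if z x < v then p.2 else (p.1, v :: (nd x).2) :: p.2)) (g := fun x _ _ => (row x).length)
    (((run_shiftRow (by fun_prop) (by fun_prop)).prodMk (Fast.run (by fun_prop))).of_le
      fun x => by simp))).of_le fun x => ?_
  simpa using foldCost_le' fun _ _ _ => le_rfl

theorem run_level {D : X → List ℕ} {rz : X → List ℕ × ℕ} {ns : X → List Node}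
    (hD : Fast D) (hrz : Fast rz) (hns : Fast ns) :
    Run (fun x => level (D x) (rz x) (ns x)) fun x => levelCost (D x) (rz x) (ns x) := by
  refine (Run.foldl hns.run (b := fun x => []) (Fast.run (by fun_prop))
    (step := fun x acc nd => expand (D x) (rz x).1 (rz x).2 nd acc)
    (g := fun x _ _ => (D x).length * ((rz x).1.length + 1))
    (run_expand (by fun_prop) (by fun_prop) (by fun_prop) (by fun_prop) (by fun_prop))).of_le
      fun x => ?_
  simpa [levelCost] using foldCost_le' fun _ _ _ => le_rfl

theorem run_nodes {D : X → List ℕ} {rzs : X → List (List ℕ × ℕ)} {gs : X → List (List (ℕ × Sol))}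
    (hD : Fast D) (hrz : Fast rzs) (hgs : Fast gs) :
    Run (fun x => nodes (D x) (rzs x) (gs x)) fun x => nodesCost (D x) (rzs x) (gs x) := by
  refine (Run.foldr hrz.run (b := fun x => [(gs x, [])]) (Fast.run (by fun_prop))
    (step := fun x => level (D x)) (g := fun x => levelCost (D x))
    (run_level (by fun_prop) (by fun_prop) (by fun_prop))).of_le fun x => ?_
  simp [nodesCost]

@[fun_prop]
theorem Fast.addPart {z s : X → ℕ} {a y : X → ℕ × Sol} (hz : Fast z) (hs : Fast s) (ha : Fast a)
    (hy : Fast y) : Fast fun x => addPart (z x) (s x) (a x) (y x) := by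
  unfold ModularDP.addPart
  fun_prop

theorem run_eval {D : X → List ℕ} {items : X → List (ℕ × List (ℕ × Sol) × ℕ)} {g : X → ℕ}
    (hD : Fast D) (hi : Run items g) :
    Run (fun x => eval (D x) (items x))
      fun x => g x + ((items x).length + 1) * ((D x).length + 1) := by
  refine (Run.foldr hi (b := fun x => (D x).map fun _ => (0, .nil))
    (Run.map hD.run (f := fun _ _ => (0, Sol.nil)) (by fun_prop))
    (step := fun x it acc => List.zipWith (addPart it.1 it.2.2) acc it.2.1)
    (g := fun x it acc => acc.length) ?_).mono 2 fun x => ?_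
  · exact (Run.zipWith (Fast.run (by fun_prop)) (Fast.run (by fun_prop))
      (f := fun p : X × (ℕ × List (ℕ × Sol) × ℕ) × List (ℕ × Sol) =>
        ModularDP.addPart p.2.1.1 p.2.1.2.2)
      (by fun_prop)).of_le fun x => by simp
  · have := foldCost_le (l := (items x).reverse) (b := (D x).map fun _ => (0, Sol.nil))
      (step := fun acc it => List.zipWith (ModularDP.addPart it.1 it.2.2) acc it.2.1)
      (g := fun acc _ => acc.length) (c := (D x).length) (fun acc => acc.length ≤ (D x).length)
      (fun acc it _ h => by simp; omega) (fun acc it _ h => h) (by simp)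
    simp at this ⊢
    nlinarith

theorem length_eval_le (D : List ℕ) (items : List (ℕ × List (ℕ × Sol) × ℕ)) :
    (eval D items).length ≤ D.length := by
  induction items with
  | nil => simp [eval]
  | cons it items ih =>
    simp only [eval, List.foldr_cons, List.length_zipWith] at ih ⊢
    omega

theorem run_merge {best es : X → List (ℕ × Sol)} {g : X → ℕ} (hb : Fast best) (he : Run es g) :
    Run (fun x => merge (best x) (es x)) fun x => g x + (best x).length := by
  refine (Run.comp (f := fun p : List (ℕ × Sol) × List (ℕ × Sol) => merge p.1 p.2)
    (g := fun p => p.1.length) ?_ (hb.run.prodMk he)).of_le fun x => by simp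
  have h : Run (fun y : (List (ℕ × Sol) × List (ℕ × Sol)) × (ℕ × Sol) × List (ℕ × Sol) =>
      List.zipWith (fun a x => if x.1 < a.1 then x else a) y.1.1 y.1.2) fun y => y.1.1.length :=
    (Run.zipWith (f := fun _ (a x : ℕ × Sol) => if x.1 < a.1 then x else a) (Fast.run (by fun_prop))
      (Fast.run (by fun_prop)) (by fun_prop)).of_le fun x => by simp
  refine (Run.lcase (Fast.run fast_fst) (Fast.run fast_snd)
    (g := fun y _ _ => y.1.length) h).of_le fun x => ?_
  rcases x with ⟨_ | _, _⟩ <;> simp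

theorem length_merge_le {best es : List (ℕ × Sol)} {m : ℕ} (hb : best.length ≤ m)
    (he : es.length ≤ m) : (merge best es).length ≤ m := by
  cases best with
  | nil => simpa [merge] using he
  | cons a best => simp [merge] at hb he ⊢; omega

theorem run_best : Run
    (fun p : List ℕ × List ℕ × List Node => ((p.2.1.foldl (· + ·) 0, p.2.2.foldl
      (fun best nd => merge best (eval p.1 (List.zipWith (fun p s => (p.1, p.2, s))
          (List.zipWith Prod.mk p.2.1 nd.1) nd.2))) []) : Tab))
    (fun p => p.2.1.length + p.2.2.length * ((p.2.1.length + 1) * (p.1.length + 1))) := by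
  refine Run.mono (Run.prodMk (Run.foldl_fast (step := fun _ a b => a + b) (Fast.run (by fun_prop))
    (by fun_prop) (by fun_prop)) (Run.foldl (Fast.run (by fun_prop)) (Fast.run (by fun_prop))
      (step := fun (p : List ℕ × List ℕ × List Node) (best : List (ℕ × Sol)) (nd : Node) =>
        merge best (eval p.1 (List.zipWith (fun p s => (p.1, p.2, s))
          (List.zipWith Prod.mk p.2.1 nd.1) nd.2)))
      -- The factor `3` covers pairing up the lists of part sizes, tables and guesses as well as the
      -- evaluation; `best.length` pays for the merge.
      (g := fun p best nd => 3 * ((p.2.1.length + 1) * (p.1.length + 1)) + best.length) ?_)) 10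
      fun p => ?_
  · refine (run_merge (by fun_prop) (run_eval (by fun_prop)
      (Run.zipWith (f := fun _ (p : ℕ × List (ℕ × Sol)) (s : ℕ) => (p.1, p.2, s))
      (Run.zipWith (f := fun _ a b => (a, b)) (Fast.run (by fun_prop)) (Fast.run (by fun_prop))
        (by fun_prop)) (Fast.run (by fun_prop)) (by fun_prop)))).of_le fun x => ?_
    obtain ⟨⟨D, zs, ns⟩, best, gs, s⟩ := x
    simp only [List.length_zipWith]
    have := Nat.mul_le_mul_right (D.length + 1)
      (show min (min zs.length gs.length) s.length + 1 ≤ zs.length + 1 by omega)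
    have : min zs.length gs.length ≤ zs.length := min_le_left _ _
    nlinarith
  · obtain ⟨D, zs, ns⟩ := p
    have := foldCost_le (l := ns) (b := [])
      (step := fun (best : List (ℕ × Sol)) (nd : Node) =>
        merge best (eval D (List.zipWith (fun p s => (p.1, p.2, s))
          (List.zipWith Prod.mk zs nd.1) nd.2)))
      (g := fun best nd => 3 * ((zs.length + 1) * (D.length + 1)) + best.length)
      (c := 3 * ((zs.length + 1) * (D.length + 1)) + D.length) (fun best => best.length ≤ D.length)
      (fun best nd _ h => length_merge_le h (length_eval_le _ _)) (fun best nd _ h => by omega)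
      (by simp)
    simp only
    refine (Nat.add_le_add_left (Nat.add_le_add_left this _) _).trans ?_
    nlinarith [Nat.zero_le (ns.length * (zs.length * D.length)), Nat.zero_le (ns.length * D.length),
      Nat.zero_le (ns.length * zs.length)]

theorem run_comb {D : X → List ℕ} {kids : X → List Tab} {rows : X → List (List ℕ)}
    (hD : Fast D) {gk gr : X → ℕ} (hk : Run kids gk) (hr : Run rows gr) :
    Run (fun x => comb (D x) (kids x) (rows x))
      fun x => gk x + gr x + combCost (D x) (kids x) (rows x) := by
  have h1 : Run (fun p : List ℕ × List Tab × List (List ℕ) =>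
      (p.1, p.2.1.map Prod.fst, p.2.1.map Prod.snd, p.2.2)) (fun p => p.2.1.length) :=
    ((Fast.run (by fun_prop)).prodMk ((Run.map (f := fun _ t => Prod.fst t) (Fast.run (by fun_prop))
      (by fun_prop)).prodMk ((Run.map (f := fun _ t => Prod.snd t) (Fast.run (by fun_prop))
      (by fun_prop)).prodMk (Fast.run (by fun_prop))))).mono 2 fun x => by simp; omega
  have h2 : Run (fun p : List ℕ × List ℕ × List (List (ℕ × Sol)) × List (List ℕ) =>
      (p.1, p.2.1, nodes p.1 (List.zipWith Prod.mk p.2.2.2 p.2.1) p.2.2.1))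
      (fun p => p.2.2.2.length + nodesCost p.1 (List.zipWith Prod.mk p.2.2.2 p.2.1) p.2.2.1) := by
    refine Run.of_le ((Fast.run (by fun_prop)).prodMk ((Fast.run (by fun_prop)).prodMk (Run.comp
      (f := fun q : List ℕ × List (List ℕ × ℕ) × List (List (ℕ × Sol)) => nodes q.1 q.2.1 q.2.2)
      (run_nodes (by fun_prop) (by fun_prop) (by fun_prop)) ((Fast.run (by fun_prop)).prodMk
      ((Run.zipWith (f := fun _ a b => (a, b)) (Fast.run (by fun_prop)) (Fast.run (by fun_prop))
        (by fun_prop)).prodMk (Fast.run (by fun_prop))))))) fun p => ?_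
    simp
  refine ((run_best.comp (h2.comp h1)).comp (hD.run.prodMk (hk.prodMk hr))).mono 2 fun x => ?_
  simp only [combCost, List.length_map]
  omega

theorem length_splitRev_le {α : Type} (n : ℕ) (l : List α) : (splitRev n l).1.length ≤ n := by
  induction n with
  | zero => simp [splitRev]
  | succ n ih =>
    simp only [splitRev, List.range_succ, List.foldl_append, List.foldl_cons, List.foldl_nil] at ih ⊢
    generalize List.foldl _ _ (List.range n) = p at ih
    rcases p with ⟨a, _ | _⟩ <;> simp <;> simp at ih <;> omega

theorem run_splitRev {α : Type} [Enc α] {n : X → ℕ} {l : X → List α} (hn : Fast n) (hl : Fast l) :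
    Run (fun x => splitRev (n x) (l x)) fun x => n x := by
  refine (Run.foldl_fast (run_range.comp_fast hn) (b := fun x => ([], l x)) (by fun_prop)
    (step := fun _ p _ => lcase p.2 p fun a t => (a :: p.1, t)) ?_).mono 2 fun x => ?_
  · exact Fast.lcase (by fun_prop) (by fun_prop) (by fun_prop)
  · simp
    omega

theorem run_readRows {n : X → ℕ} {l : X → List ℕ} (hn : Fast n) (hl : Fast l) :
    Run (fun x => readRows (n x) (l x)) fun x => n x * (n x + 1) := by
  refine (Run.foldl (run_range.comp_fast hn) (b := fun x => ([], l x)) (Fast.run (by fun_prop))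
    (step := fun x p _ => ((splitRev (n x) p.2).1.reverse :: p.1, (splitRev (n x) p.2).2))
    (g := fun x p _ => 3 * n x) ?_).mono 10 fun x => ?_
  · have h : Run (fun p : X × (List (List ℕ) × List ℕ) × ℕ => splitRev (n p.1) p.2.1.2)
      fun p => n p.1 := run_splitRev (by fun_prop) (by fun_prop)
    refine ((Run.comp (f := fun q : List (List ℕ) × List ℕ × List ℕ => (q.2.1.reverse :: q.1, q.2.2))
      (g := fun q => q.2.1.length) ?_ ((Fast.run (f := fun p : X × (List (List ℕ) × List ℕ) × ℕ =>
        p.2.1.1) (by fun_prop)).prodMk h))).of_le fun x => ?_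
    · exact (Run.prodMk (Fast.comp_run (f := fun p : List ℕ × List (List ℕ) => p.1 :: p.2)
        (by fun_prop) ((Run.reverse (Fast.run (by fun_prop))).prodMk (Fast.run (by fun_prop))))
        (Fast.run (by fun_prop))).of_le fun x => by simp
    · have := length_splitRev_le (n x.1) x.2.1.2
      simp
      omega
  · have := foldCost_le' (l := List.range (n x)) (b := ([], l x))
      (step := fun p _ => ((splitRev (n x) p.2).1.reverse :: p.1, (splitRev (n x) p.2).2))
      (g := fun p _ => 3 * n x) (c := 3 * n x) fun _ _ _ => le_rfl
    simp at this ⊢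
    nlinarith

theorem run_reduce {D : X → List ℕ} {n : X → ℕ} {rows : X → List (List ℕ)} {stack : X → List Tab}
    {g : X → ℕ} (hD : Fast D) (hn : Fast n) (hr : Run rows g) (hs : Fast stack) :
    Run (fun x => reduce (D x) (n x) (rows x) (stack x))
      fun x => g x + reduceCost (D x) (n x) (rows x) (stack x) := by
  refine (Run.comp (f := fun p : List ℕ × List (List ℕ) × List Tab × List Tab =>
      comb p.1 p.2.2.1 p.2.1 :: p.2.2.2) (g := fun p => combCost p.1 p.2.2.1 p.2.1) ?_
    (hD.run.prodMk (hr.prodMk (run_splitRev hn hs)))).of_le fun x => ?_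
  · exact (Fast.comp_run (f := fun p : Tab × List Tab => p.1 :: p.2) (by fun_prop)
      ((run_comb (by fun_prop) (Fast.run (by fun_prop)) (Fast.run (by fun_prop))).prodMk
      (Fast.run (by fun_prop)))).of_le fun x => by simp
  · simp only [reduceCost]
    omega

theorem run_push {t : X → Tab} {l : X → List Tab} {r : X → List ℕ} {g g' : X → ℕ} (ht : Run t g)
    (hl : Fast l) (hr : Run r g') : Run (fun x => (t x :: l x, r x)) fun x => g x + g' x :=
  ((Fast.comp_run (f := fun p : Tab × List Tab => p.1 :: p.2) (by fun_prop)
    (ht.prodMk hl.run)).prodMk hr).of_le fun x => by simp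

theorem run_leafTab {D : X → List ℕ} {v : X → ℕ} (hD : Fast D) (hv : Fast v) :
    Run (fun x => leafTab (D x) (v x)) fun x => (D x).length :=
  ((Fast.run (f := fun _ => 1) (by fun_prop)).prodMk (Run.map (f := fun x r => if 0 < r then
    (1, Sol.cons 1 0 (.leaf (v x)) .nil) else (0, Sol.leaf (v x))) hD.run
      (by fun_prop))).of_le fun x => by simp

theorem length_readRows (n : ℕ) (l : List ℕ) : (readRows n l).1.length = n := by
  have (k : ℕ) : ((List.range k).foldl (fun p _ => ((splitRev n p.2).1.reverse :: p.1,
      (splitRev n p.2).2)) (([] : List (List ℕ)), l)).1.length = k := by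
    induction k with
    | zero => rfl
    | succ k ih => simp [List.range_succ, ih]
  exact this n

theorem run_substStep {D : X → List ℕ} {n : X → ℕ} {stack : X → List Tab} {l : X → List ℕ}
    (hD : Fast D) (hn : Fast n) (hs : Fast stack) (hl : Fast l) :
    Run (fun x => (reduce (D x) (n x) (readRows (n x) (l x)).1.reverse (stack x),
      (readRows (n x) (l x)).2)) fun x =>
      n x * (n x + 1) + reduceCost (D x) (n x) (readRows (n x) (l x)).1.reverse (stack x) := by
  refine (Run.comp (f := fun p : X × List (List ℕ) × List ℕ =>
      (reduce (D p.1) (n p.1) p.2.1.reverse (stack p.1), p.2.2))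
    (g := fun p => p.2.1.length + reduceCost (D p.1) (n p.1) p.2.1.reverse (stack p.1)) ?_
    (Fast.id.run.prodMk (run_readRows hn hl))).mono 2 fun x => ?_
  · exact ((run_reduce (g := fun p : X × List (List ℕ) × List ℕ => p.2.1.length) (by fun_prop)
      (by fun_prop) ((Run.reverse (Fast.run (by fun_prop))).of_le fun x => by simp)
      (by fun_prop)).prodMk (Fast.run (by fun_prop))).of_le fun x => by simp
  · have := length_readRows (n x) (l x)
    simp only
    nlinarith

theorem run_parseStep {D : X → List ℕ} {st : X → List Tab × List ℕ} (hD : Fast D)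
    (hst : Fast st) : Run (fun x => parseStep (D x) (st x)) fun x => parseStepCost (D x) (st x) := by
  have h₀ : Run (fun y : X × ℕ × List ℕ => lcase y.2.2 (st y.1) fun v l' =>
      (leafTab (D y.1) v :: (st y.1).1, l'))
      fun y => lcase y.2.2 0 fun _ _ => (D y.1).length := by
    refine (Run.lcase (l := fun y : X × ℕ × List ℕ => y.2.2) (z := fun y => st y.1)
      (f := fun y v l' => (leafTab (D y.1) v :: (st y.1).1, l'))
      (g := fun y _ _ => (D y.1).length) (Fast.run (by fun_prop)) (Fast.run (by fun_prop))
      ((run_push (run_leafTab (by fun_prop) (by fun_prop)) (by fun_prop)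
        (Fast.run (by fun_prop))).of_le fun x => by simp)).of_le fun x => by simp
  have h₁ (rows : List (List ℕ)) : Run (fun y : X × ℕ × List ℕ =>
      (reduce (D y.1) 2 rows (st y.1).1, y.2.2))
      fun y => reduceCost (D y.1) 2 rows (st y.1).1 :=
    ((run_reduce (by fun_prop) (by fun_prop) (Fast.run (by fun_prop)) (by fun_prop)).prodMk
      (Fast.run (by fun_prop))).of_le fun x => by simp
  have h₂ : Run (fun y : X × ℕ × List ℕ => lcase y.2.2 (st y.1) fun n l' =>
      (reduce (D y.1) n (readRows n l').1.reverse (st y.1).1, (readRows n l').2))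
      fun y => lcase y.2.2 0 fun n l' =>
        n * (n + 1) + reduceCost (D y.1) n (readRows n l').1.reverse (st y.1).1 := by
    refine (Run.lcase (l := fun y : X × ℕ × List ℕ => y.2.2) (z := fun y => st y.1)
      (f := fun y n l' =>
        (reduce (D y.1) n (readRows n l').1.reverse (st y.1).1, (readRows n l').2))
      (g := fun y n l' =>
        n * (n + 1) + reduceCost (D y.1) n (readRows n l').1.reverse (st y.1).1)
      (Fast.run (by fun_prop)) (Fast.run (by fun_prop))
      (run_substStep (by fun_prop) (by fun_prop) (by fun_prop) (by fun_prop))).of_le fun x => by simp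
  refine (Run.lcase (l := fun x => (st x).2) (g₀ := fun _ => 0) (g₁ := fun _ => 0) (z := st)
    (f := fun x c l =>
      if c < 1 then lcase l (st x) fun v l' => (leafTab (D x) v :: (st x).1, l')
      else if c < 2 then (reduce (D x) 2 [[0, 0], [0, 0]] (st x).1, l)
      else if c < 3 then (reduce (D x) 2 [[0, 1], [1, 0]] (st x).1, l)
      else lcase l (st x) fun n l' =>
        (reduce (D x) n (readRows n l').1.reverse (st x).1, (readRows n l').2))
    (g := fun x c l =>
      if c < 1 then lcase l 0 fun _ _ => (D x).length
      else if c < 2 then reduceCost (D x) 2 [[0, 0], [0, 0]] (st x).1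
      else if c < 3 then reduceCost (D x) 2 [[0, 1], [1, 0]] (st x).1
      else lcase l 0 fun n l' =>
        n * (n + 1) + reduceCost (D x) n (readRows n l').1.reverse (st x).1)
    (Fast.run (by fun_prop)) hst.run ?_).of_le fun x => by simp [parseStepCost]
  exact Run.ite (a := fun y : X × ℕ × List ℕ => y.2.1) (by fun_prop) (by fun_prop) h₀
    (Run.ite (a := fun y : X × ℕ × List ℕ => y.2.1) (by fun_prop) (by fun_prop) (h₁ _)
    (Run.ite (a := fun y : X × ℕ × List ℕ => y.2.1) (by fun_prop) (by fun_prop) (h₁ _) h₂))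

theorem run_final {stack : X → List Tab} (hs : Fast stack) : Run (fun x => final (stack x))
    fun x => lcase (stack x) 0 fun t _ => t.2.length := by
  refine (fast_snd.comp_run (Run.lcase hs.run (z := fun _ => (0, Sol.nil)) (g₁ := fun _ => 0)
    (Fast.run (by fun_prop)) (f := fun _ t _ => t.2.foldl (fun _ e => e) (0, Sol.nil))
    (g := fun _ t _ => t.2.length)
    ((Run.foldl_fast (Fast.run (by fun_prop)) (by fun_prop) (step := fun _ _ e => e)
      (by fun_prop)).of_le fun x => by simp))).of_le fun x => ?_
  simp

theorem run_solve : Run solve solveCost := by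
  have h : Run (fun x : List ℕ × ℕ × List ℕ => (parse (List.range (x.2.1 + 1)) x.2.2).1)
      fun x => x.2.1 + x.2.2.length + foldCost (fun st _ => parseStep (List.range (x.2.1 + 1)) st)
      (fun st _ => parseStepCost (List.range (x.2.1 + 1)) st) x.2.2 ([], x.2.2) := by
    refine (fast_fst.comp_run (Run.comp (f := fun y : List ℕ × List ℕ => parse y.1 y.2)
      (g := fun y => y.2.length + foldCost (fun st _ => parseStep y.1 st)
        (fun st _ => parseStepCost y.1 st) y.2 ([], y.2)) ?_
      ((run_range.comp_fast (h := fun x : List ℕ × ℕ × List ℕ => x.2.1 + 1) (by fun_prop)).prodMk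
      (Fast.run (f := fun x : List ℕ × ℕ × List ℕ => x.2.2) (by fun_prop))))).mono 2 fun x => ?_
    · exact (Run.foldl (l := fun y : List ℕ × List ℕ => y.2) (b := fun y => ([], y.2))
        (step := fun y st _ => parseStep y.1 st) (g := fun y st _ => parseStepCost y.1 st)
        (Fast.run (by fun_prop)) (Fast.run (by fun_prop))
        (run_parseStep (by fun_prop) (by fun_prop))).of_le fun x => by simp
    · simp only
      omega
  have h' : Run (fun p : (List ℕ × ℕ × List ℕ) × List Tab => emitAll p.1.2.2 (final p.2))
      fun p => p.1.2.2.length + lcase p.2 0 fun t _ => t.2.length := by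
    have he : Run (fun q : List ℕ × Sol => emitAll q.1 q.2) fun q => q.1.length :=
      (fast_snd.comp_run (Run.foldl_fast (l := fun q : List ℕ × Sol => q.1)
        (b := fun q => ([(q.2, 0)], [])) (step := fun _ σ _ => Sol.step (Sol.step (Sol.step σ)))
        (Fast.run (by fun_prop)) (by fun_prop) (fast_solStep.comp (fast_solStep.comp
          (fast_solStep.comp (by fun_prop)))))).of_le fun x => by simp
    exact (he.comp ((Fast.run (f := fun p : (List ℕ × ℕ × List ℕ) × List Tab => p.1.2.2)
      (by fun_prop)).prodMk (run_final (stack := fun p : (List ℕ × ℕ × List ℕ) × List Tab => p.2)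
      (by fun_prop)))).of_le fun x => by simp; omega
  refine (Run.lcase Fast.id.run (z := fun _ => []) (Fast.run (by fun_prop))
    (f := fun _ d code => emitAll code (final (parse (List.range (d + 1)) code).1))
    (g := fun x d code => 2 * solveCost (d :: code))
    ((h'.comp (Fast.id.run.prodMk h)).of_le fun x => ?_)).mono 2 fun x => ?_
  · simp only [solveCost, lcase_cons]
    omega
  · cases x <;> simp [solveCost]

end RAM

/-! ### Evaluation of descriptions, iterations, sizes of lists -/

namespace Sol

open RAM

/-- Each step removes one constructor from the stack, and `cons` puts its two children there; thus
`s.size` steps treat `s` completely without touching the stack below. Vertices are prepended, hence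
the reversal. -/
theorem iterate_step (s : Sol) (e : ℕ) (t : List (Sol × ℕ)) (out : List ℕ) :
    step^[s.size] ((s, e) :: t, out) = (t, (s.emit e).reverse ++ out) := by
  induction s generalizing e t out with
  | nil => simp [size, emit, step, elim]
  | leaf v =>
    by_cases h : 0 < e <;> simp [size, emit, step, elim, h]
  | cons b c k r ihk ihr =>
    rw [size, Function.iterate_succ_apply, add_comm k.size, Function.iterate_add_apply]
    simp only [step, elim, lcase_cons, ihk]
    simp [ihr, emit]

theorem iterate_step_nil (m : ℕ) (out : List ℕ) : step^[m] ([], out) = ([], out) :=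
  Function.iterate_fixed rfl m

end Sol

namespace ModularDP

open RAM

/-- Steps on an empty stack do nothing, so any sufficient amount of fuel gives the same result.
Three steps per input symbol suffice for the size bound in `EntryOK`, as every vertex accounts for
at least two symbols. -/
theorem emitAll_eq (fuel : List ℕ) (s : Sol) (h : s.size ≤ 3 * fuel.length) :
    emitAll fuel s = (s.emit 0).reverse := by
  have h3 : (fun σ => Sol.step (Sol.step (Sol.step σ))) = Sol.step^[3] := rfl
  rw [emitAll, List.foldl_const, h3, ← Function.iterate_mul, ← Nat.sub_add_cancel h,
    Function.iterate_add_apply, Sol.iterate_step, Sol.iterate_step_nil]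
  simp

/-- The cost of a number of iterations of `f`, if one of them has the cost `g`. -/
def iterCost {α : Type} (f : α → α) (g : α → ℕ) : ℕ → α → ℕ
  | 0, _ => 0
  | m + 1, a => g a + 1 + iterCost f g m (f a)

theorem foldCost_const {α β : Type} (f : α → α) (g : α → ℕ) (l : List β) (a : α) :
    foldCost (fun a _ => f a) (fun a _ => g a) l a = iterCost f g l.length a := by
  induction l generalizing a with
  | nil => rfl
  | cons b l ih => simp [foldCost, iterCost, ih]

theorem iterCost_add {α : Type} (f : α → α) (g : α → ℕ) (m k : ℕ) (a : α) :
    iterCost f g (m + k) a = iterCost f g m a + iterCost f g k (f^[m] a) := by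
  induction m generalizing a with
  | zero => simp [iterCost]
  | succ m ih =>
    rw [Nat.add_right_comm]
    simp only [iterCost, ih, Function.iterate_succ_apply]
    omega

theorem iterCost_fixed {α : Type} {f : α → α} {g : α → ℕ} {a : α} (hf : f a = a) (hg : g a = 0)
    (m : ℕ) : iterCost f g m a = m := by
  induction m with
  | zero => rfl
  | succ m ih => simp [iterCost, hf, hg, ih, add_comm]

theorem splitRev_append {α : Type} (l r : List α) :
    splitRev l.length (l ++ r) = (l.reverse, r) := by
  induction l using List.reverseRecOn generalizing r with
  | nil => rfl
  | append_singleton l a ih =>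
    have h : splitRev (l.length + 1) (l ++ ([a] ++ r)) =
        lcase (splitRev l.length (l ++ ([a] ++ r))).2 (splitRev l.length (l ++ ([a] ++ r)))
          fun b t => (b :: (splitRev l.length (l ++ ([a] ++ r))).1, t) := by
      conv_lhs => rw [splitRev, List.range_succ, List.foldl_append]
      rfl
    rw [List.length_append, List.length_singleton, List.append_assoc, h, ih]
    simp

theorem readRows_append (n : ℕ) (rows : List (List ℕ)) (hn : rows.length = n)
    (h : ∀ row ∈ rows, row.length = n) (r : List ℕ) :
    readRows n (rows.flatten ++ r) = (rows.reverse, r) := by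
  have key (rows : List (List ℕ)) (h : ∀ row ∈ rows, row.length = n) (r : List ℕ) :
      (List.range rows.length).foldl (fun p _ => ((splitRev n p.2).1.reverse :: p.1,
        (splitRev n p.2).2)) (([] : List (List ℕ)), rows.flatten ++ r) = (rows.reverse, r) := by
    induction rows using List.reverseRecOn generalizing r with
    | nil => rfl
    | append_singleton rows a ih =>
      have ha : a.length = n := h a (by simp)
      rw [List.length_append, List.length_singleton, List.range_succ, List.foldl_append,
        List.flatten_append, List.append_assoc, ih fun row hr => h row (by simp [hr])]
      have := splitRev_append a r
      rw [ha] at this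
      simp [this]
  rw [readRows]
  subst hn
  exact key rows h r

/-! ### Enumeration of the guessed sizes and its cost -/

theorem foldl_expand (row : List ℕ) (z : ℕ) (nd : Node) (acc : List Node) (m : ℕ) :
    ((List.range m).foldl (fun p v => (shiftRow row p.1,
      if z < v then p.2 else (p.1, v :: nd.2) :: p.2)) (nd.1, acc)).1 = (shiftRow row)^[m] nd.1 := by
  induction m with
  | zero => rfl
  | succ m ih =>
    simp only [List.range_succ, List.foldl_append, List.foldl_cons, List.foldl_nil, ih,
      Function.iterate_succ_apply']

/-- When the loop arrives at the size `v`, the adjacent tables have been shifted exactly `v` times.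
Each new guess thus costs one pass over a row instead of a fresh computation. -/
theorem mem_expand {m : ℕ} {row : List ℕ} {z : ℕ} {nd nd' : Node} {acc : List Node} :
    nd' ∈ expand (List.range m) row z nd acc ↔
      nd' ∈ acc ∨ ∃ v < m, v ≤ z ∧ nd' = ((shiftRow row)^[v] nd.1, v :: nd.2) := by
  induction m with
  | zero => simp [expand]
  | succ m ih =>
    rw [expand] at ih ⊢
    rw [List.range_succ, List.foldl_append, List.foldl_cons, List.foldl_nil]
    simp only [foldl_expand, Nat.lt_succ_iff_lt_or_eq, or_and_right, exists_or, exists_eq_left]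
    split_ifs with h
    · rw [ih]
      simp [Nat.not_le.2 h]
    · rw [List.mem_cons, ih]
      have : m ≤ z := by omega
      simp only [this, true_and]
      exact or_rotate

theorem length_expand_le (D row : List ℕ) (z : ℕ) (nd : Node) (acc : List Node) :
    (expand D row z nd acc).length ≤ acc.length + D.length := by
  have key (p : List (List (ℕ × Sol)) × List Node) :
      (D.foldl (fun p v => (shiftRow row p.1, if z < v then p.2 else (p.1, v :: nd.2) :: p.2))
        p).2.length ≤ p.2.length + D.length := by
    induction D generalizing p with
    | nil => simp
    | cons v D ih =>
      refine (ih _).trans ?_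
      dsimp only
      split_ifs
      · simp
      · simp
        omega
  exact key _

theorem mem_level {m : ℕ} {rz : List ℕ × ℕ} {ns : List Node} {nd' : Node} :
    nd' ∈ level (List.range m) rz ns ↔
      ∃ nd ∈ ns, ∃ v < m, v ≤ rz.2 ∧ nd' = ((shiftRow rz.1)^[v] nd.1, v :: nd.2) := by
  have key (acc : List Node) : nd' ∈ ns.foldl
      (fun acc nd => expand (List.range m) rz.1 rz.2 nd acc) acc ↔ nd' ∈ acc ∨
        ∃ nd ∈ ns, ∃ v < m, v ≤ rz.2 ∧ nd' = ((shiftRow rz.1)^[v] nd.1, v :: nd.2) := by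
    induction ns generalizing acc with
    | nil => simp
    | cons nd ns ih => simp only [List.foldl_cons, ih, mem_expand, List.exists_mem_cons_iff, or_assoc]
  simpa [level] using key []

theorem length_level_le (D : List ℕ) (rz : List ℕ × ℕ) (ns : List Node) :
    (level D rz ns).length ≤ ns.length * D.length := by
  have key (acc : List Node) : (ns.foldl (fun acc nd => expand D rz.1 rz.2 nd acc) acc).length ≤
      acc.length + ns.length * D.length := by
    induction ns generalizing acc with
    | nil => simp
    | cons nd ns ih =>
      have := length_expand_le D rz.1 rz.2 nd acc
      refine (ih _).trans ?_
      dsimp only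
      rw [List.length_cons, Nat.add_mul, one_mul]
      omega
  simpa [level] using key []

theorem length_nodes_le (D : List ℕ) (rzs : List (List ℕ × ℕ)) (gs : List (List (ℕ × Sol))) :
    (nodes D rzs gs).length ≤ D.length ^ rzs.length := by
  induction rzs with
  | nil => simp [nodes]
  | cons rz rzs ih =>
    rw [List.length_cons, pow_succ]
    exact (length_level_le _ _ _).trans (Nat.mul_le_mul_right _ ih)

theorem foldCost_append {α β : Type} (step : β → α → β) (g : β → α → ℕ) (l l' : List α) (b : β) :
    foldCost step g (l ++ l') b = foldCost step g l b + foldCost step g l' (l.foldl step b) := by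
  induction l generalizing b with
  | nil => simp [foldCost]
  | cons a l ih => simp [foldCost, ih, add_assoc]

/-- Level sizes are bounded by powers of `D.length ≥ 2`, so the costs of the levels are dominated by
a geometric sum. -/
theorem nodesCost_le {D : List ℕ} {rzs : List (List ℕ × ℕ)} {gs : List (List (ℕ × Sol))} {w : ℕ}
    (hD : 2 ≤ D.length) (hw : ∀ rz ∈ rzs, rz.1.length ≤ w) :
    nodesCost D rzs gs ≤ rzs.length + D.length ^ rzs.length * (D.length * (w + 1) + 2) := by
  rw [nodesCost]
  refine Nat.add_le_add_left ?_ _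
  induction rzs with
  | nil => simp [foldCost]
  | cons rz rzs ih =>
    have h := ih fun rz h => hw rz (by simp [h])
    have h1 := length_nodes_le D rzs gs
    have h2 : levelCost D rz (nodes D rzs gs) ≤ D.length ^ rzs.length * (D.length * (w + 1) + 1) :=
      Nat.mul_le_mul h1 (by gcongr; exact hw rz (by simp))
    have h3 : 0 < D.length ^ rzs.length := by positivity
    rw [List.reverse_cons, foldCost_append]
    simp only [List.foldl_reverse, foldCost, List.length_cons, pow_succ]
    change _ + (levelCost D rz (nodes D rzs gs) + 1 + 0) ≤ _
    nlinarith [Nat.mul_le_mul_right (D.length ^ rzs.length * (D.length * (w + 1) + 2)) hD]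

/-- Enumerating and evaluating the at most `(d + 1) ^ l` guesses each contribute a bound of `6 * l *
d` per guess, which gives the constant `12`. -/
theorem combCost_le {D : List ℕ} {kids : List Tab} {rows : List (List ℕ)} {d l : ℕ}
    (hD : D.length = d + 1) (hd : 0 < d) (hl : 2 ≤ l) (hk : kids.length = l) (hr : rows.length = l)
    (hrow : ∀ row ∈ rows, row.length = l) :
    combCost D kids rows ≤ 3 * l + 12 * l * (d * (d + 1) ^ l) := by
  have h := nodesCost_le (D := D) (rzs := List.zipWith Prod.mk rows (kids.map Prod.fst))
    (gs := kids.map Prod.snd) (w := l) (by omega) ?_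
  · have h1 := length_nodes_le D (List.zipWith Prod.mk rows (kids.map Prod.fst)) (kids.map Prod.snd)
    simp only [List.length_zipWith, List.length_map, hk, hr, min_self, hD] at h h1
    rw [combCost, hk, hr, hD]
    have h2 := Nat.mul_le_mul_right ((l + 1) * (d + 1 + 1)) h1
    have h3 : (d + 1) * (l + 1) + 2 ≤ 6 * (l * d) := by nlinarith
    have h4 : (l + 1) * (d + 1 + 1) ≤ 6 * (l * d) := by nlinarith
    have h5 := Nat.mul_le_mul_left ((d + 1) ^ l) h3
    have h6 := Nat.mul_le_mul_left ((d + 1) ^ l) h4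
    nlinarith
  · intro rz hrz
    obtain ⟨i, hi, rfl⟩ := List.mem_iff_getElem.1 hrz
    simp [hrow]

end ModularDP

/-! ### The tables computed for a substitution -/

namespace ModularDP

open RAM

/-- The table with the entries `E (0 - k), …, E (d - k), …`. -/
def shifted (d : ℕ) (E : ℕ → ℕ × Sol) (k : ℕ) : List (ℕ × Sol) :=
  (List.range (d + 1 + k)).map fun r => E (r - k)

/-- The index `0` gives the demand `0` for both shifts, by truncation, and the index `r + 1` of the
new list corresponds to the index `r` of the old one. Hence only the head has to be duplicated, and
the list grows by one. -/
theorem shift_shifted (d : ℕ) (E : ℕ → ℕ × Sol) (k : ℕ) :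
    shift (shifted d E k) = shifted d E (k + 1) := by
  simp only [shifted, show d + 1 + (k + 1) = (d + k) + 1 + 1 by omega,
    show d + 1 + k = d + k + 1 by omega, List.range_succ_eq_map, shift, List.map_cons, lcase_cons,
    List.map_map]
  simp [Function.comp_def]

section

variable {ι : Type} {d : ℕ} {E : ι → ℕ → ℕ × Sol} {is : List ι}

theorem shiftRow_map {h : ι → ℕ} (hh : ∀ i, h i ≤ 1) (k : ι → ℕ) :
    shiftRow (is.map h) (is.map fun i => shifted d (E i) (k i)) =
      is.map fun i => shifted d (E i) (k i + h i) := by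
  simp only [shiftRow, List.zipWith_map, List.zipWith_self]
  refine List.map_congr_left fun i _ => ?_
  have := hh i
  split_ifs with h0
  · rw [shift_shifted, show h i = 1 by omega]
  · rw [show h i = 0 by omega, add_zero]

theorem iterate_shiftRow {h : ι → ℕ} (hh : ∀ i, h i ≤ 1) (k : ι → ℕ) (v : ℕ) :
    (shiftRow (is.map h))^[v] (is.map fun i => shifted d (E i) (k i)) =
      is.map fun i => shifted d (E i) (k i + h i * v) := by
  induction v with
  | zero => simp
  | succ v ih =>
    rw [Function.iterate_succ_apply', ih, shiftRow_map hh]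
    simp only [mul_add, mul_one, add_assoc]

/-- The nodes correspond to the admissible size vectors `σ`; the table of part `i` is stored with
its demands lowered by the contribution `∑ h j i * σ j` of the guesses made so far. -/
theorem mem_nodes {h : ι → ι → ℕ} (hh : ∀ j i, h j i ≤ 1) (z : ι → ℕ) {js : List ι}
    (hjs : js.Nodup) (nd : Node) :
    nd ∈ nodes (List.range (d + 1)) (js.map fun j => (is.map (h j), z j))
        (is.map fun i => shifted d (E i) 0) ↔
      ∃ σ : ι → ℕ, (∀ j ∈ js, σ j ≤ d ∧ σ j ≤ z j) ∧
        nd = (is.map fun i => shifted d (E i) (js.map fun j => h j i * σ j).sum, js.map σ) := by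
  classical
  induction js generalizing nd with
  | nil => simp [nodes]
  | cons j js ih =>
    rw [List.nodup_cons] at hjs
    have := ih hjs.2
    simp only [nodes, List.map_cons, List.foldr_cons] at this ⊢
    rw [mem_level]
    constructor
    · rintro ⟨nd₁, h₁, v, hv, hz, rfl⟩
      obtain ⟨σ, hσ, rfl⟩ := (this nd₁).1 h₁
      have hne (i) (hi : i ∈ js) : i ≠ j := fun h => hjs.1 (h ▸ hi)
      -- As `j` does not occur in `js`, changing `σ` at `j` leaves the earlier contributions
      -- unchanged.
      refine ⟨Function.update σ j v, ?_, ?_⟩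
      · intro i hi
        rcases List.mem_cons.1 hi with rfl | hi
        · simpa using ⟨by omega, hz⟩
        · simpa [Function.update_of_ne (hne i hi)] using hσ i hi
      · have e1 (f : ℕ → ι → ℕ) : (js.map fun i => f (Function.update σ j v i) i) =
            js.map fun i => f (σ i) i :=
          List.map_congr_left fun i hi => by rw [Function.update_of_ne (hne i hi)]
        have e2 := e1 fun x _ => x
        have e3 (i : ι) := e1 fun x i' => h i' i * x
        simp only [iterate_shiftRow (hh j), List.sum_cons, e3, Function.update_self,
          e2, add_comm]
    · rintro ⟨σ, hσ, rfl⟩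
      refine ⟨_, (this _).2 ⟨σ, fun i hi => hσ i (by simp [hi]), rfl⟩, σ j, ?_⟩
      have := hσ j (by simp)
      refine ⟨by omega, this.2, ?_⟩
      simp only [iterate_shiftRow (hh j), List.sum_cons, add_comm]

/-- The solution for the demand `r` that is found for the sizes `σ` of the parts, if `k i` chosen
vertices outside of the part `i` are adjacent to this part. -/
def part (z : ι → ℕ) (E : ι → ℕ → ℕ × Sol) (k σ : ι → ℕ) (is : List ι) (r : ℕ) : ℕ × Sol :=
  is.foldr (fun i a => addPart (z i) (σ i) a (E i (r - k i))) (0, .nil)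

theorem zipWith_range {α β γ : Type} (f : α → β → γ) (a : ℕ → α) (b : ℕ → β) {m n : ℕ}
    (h : m ≤ n) : List.zipWith f ((List.range m).map a) ((List.range n).map b) =
      (List.range m).map fun r => f (a r) (b r) := by
  obtain ⟨k, rfl⟩ := Nat.exists_eq_add_of_le h
  refine List.ext_getElem (by simp) fun i hi _ => by simp

theorem eval_map (z k σ : ι → ℕ) :
    eval (List.range (d + 1)) (is.map fun i => (z i, shifted d (E i) (k i), σ i)) =
      (List.range (d + 1)).map (part z E k σ is) := by
  induction is with
  | nil => exact List.map_congr_left fun _ _ => rfl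
  | cons i is ih =>
    simp only [eval, List.map_cons, List.foldr_cons] at ih ⊢
    rw [ih, shifted, zipWith_range _ _ _ (by omega)]
    rfl

/-- The empty list stands for the absence of a candidate, so the first merge returns its second
argument. Afterwards minima are taken for each demand separately, and different demands may be won
by different `x`. -/
theorem foldl_merge {α : Type} (F : α → ℕ → ℕ × Sol) (l : List α) (a : α) :
    ∃ B : ℕ → ℕ × Sol, (a :: l).foldl (fun best x => merge best ((List.range (d + 1)).map (F x))) [] =
      (List.range (d + 1)).map B ∧
      ∀ r, (∃ x ∈ a :: l, B r = F x r) ∧ ∀ x ∈ a :: l, (B r).1 ≤ (F x r).1 := by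
  induction l using List.reverseRecOn with
  | nil => exact ⟨F a, by simp [merge], by simp⟩
  | append_singleton l b ih =>
    obtain ⟨B, hB, h⟩ := ih
    refine ⟨fun r => if (F b r).1 < (B r).1 then F b r else B r, ?_, fun r => ?_⟩
    · rw [← List.cons_append, List.foldl_append, hB]
      have hm (es : List (ℕ × Sol)) : merge ((List.range (d + 1)).map B) es =
          List.zipWith (fun a x => if x.1 < a.1 then x else a) ((List.range (d + 1)).map B) es := by
        rw [List.range_succ_eq_map]
        rfl
      simp only [List.foldl_cons, List.foldl_nil, hm]
      rw [zipWith_range _ _ _ le_rfl]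
    · obtain ⟨⟨x, hx, hxr⟩, hmin⟩ := h r
      rw [← List.cons_append]
      dsimp only
      split_ifs with hlt
      · refine ⟨⟨b, by simp, rfl⟩, fun y hy => ?_⟩
        rcases List.mem_append.1 hy with hy | hy
        · exact hlt.le.trans (hmin y hy)
        · simp at hy; simp [hy]
      · refine ⟨⟨x, List.mem_append_left _ hx, hxr⟩, fun y hy => ?_⟩
        rcases List.mem_append.1 hy with hy | hy
        · exact hmin y hy
        · simp at hy; subst hy; omega

/-- This replaces the list computation by an optimisation problem: for every demand, `comb` returns
a `part` of least size over all admissible `σ`. -/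
theorem comb_map {h : ι → ι → ℕ} (hh : ∀ j i, h j i ≤ 1) (z : ι → ℕ) (his : is.Nodup) :
    ∃ B : ℕ → ℕ × Sol, comb (List.range (d + 1)) (is.map fun i => (z i, (List.range (d + 1)).map (E i)))
        (is.map fun j => is.map (h j)) = ((is.map z).sum, (List.range (d + 1)).map B) ∧
      ∀ r ≤ d, (∃ σ : ι → ℕ, (∀ i ∈ is, σ i ≤ d ∧ σ i ≤ z i) ∧
          B r = part z E (fun i => (is.map fun j => h j i * σ j).sum) σ is r) ∧
        ∀ σ : ι → ℕ, (∀ i ∈ is, σ i ≤ d ∧ σ i ≤ z i) →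
          (B r).1 ≤ (part z E (fun i => (is.map fun j => h j i * σ j).sum) σ is r).1 := by
  have e1 : (is.map fun i => (z i, (List.range (d + 1)).map (E i))).map Prod.fst = is.map z := by
    simp [Function.comp_def]
  have e2 : (is.map fun i => (z i, (List.range (d + 1)).map (E i))).map Prod.snd =
      is.map fun i => shifted d (E i) 0 := by
    simp [Function.comp_def, shifted]
  have e3 : List.zipWith Prod.mk (is.map fun j => is.map (h j)) (is.map z) =
      is.map fun j => (is.map (h j), z j) := by
    simp only [List.zipWith_map, List.zipWith_self]
  have hmem := fun nd => mem_nodes (d := d) (E := E) (is := is) hh z his nd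
  rw [comb, e1, e2, e3]
  set ns := nodes (List.range (d + 1)) (is.map fun j => (is.map (h j), z j))
    (is.map fun i => shifted d (E i) 0) with hns
  let ev : Node → List (ℕ × Sol) := fun nd => eval (List.range (d + 1))
    (List.zipWith (fun p s => (p.1, p.2, s)) (List.zipWith Prod.mk (is.map z) nd.1) nd.2)
  -- The default value is never used for demands `r ≤ d`.
  let F : Node → ℕ → ℕ × Sol := fun nd r => (ev nd).getD r (0, .nil)
  have hev (σ : ι → ℕ) (nd : Node) (hnd : nd = (is.map fun i => shifted d (E i)
      (is.map fun j => h j i * σ j).sum, is.map σ)) : ev nd = (List.range (d + 1)).map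
        (part z E (fun i => (is.map fun j => h j i * σ j).sum) σ is) := by
    simp only [ev, hnd, List.zipWith_map, List.zipWith_self]
    exact eval_map ..
  have hF (σ : ι → ℕ) (nd : Node) (hnd : nd = (is.map fun i => shifted d (E i)
      (is.map fun j => h j i * σ j).sum, is.map σ)) (r : ℕ) (hr : r ≤ d) :
      F nd r = part z E (fun i => (is.map fun j => h j i * σ j).sum) σ is r := by
    simp only [F, hev σ nd hnd]
    simp [List.getD, Nat.lt_succ_iff.2 hr]
  -- The guess `σ = 0` is always admissible, so there is at least one candidate.
  obtain ⟨a, l, hal⟩ : ∃ a l, ns = a :: l := by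
    refine List.exists_cons_of_ne_nil (List.ne_nil_of_mem ((hmem _).2 ⟨fun _ => 0, by simp, rfl⟩))
  obtain ⟨B, hB, hBr⟩ := foldl_merge (d := d) F l a
  rw [← hal] at hB hBr
  refine ⟨B, ?_, fun r hr => ⟨?_, fun σ hσ => ?_⟩⟩
  · rw [← hB, List.sum_eq_foldl]
    refine Prod.ext rfl (List.foldl_ext _ _ _ fun best nd hnd => ?_)
    obtain ⟨σ, -, hσ⟩ := (hmem nd).1 hnd
    change merge best (ev nd) = _
    congr 1
    rw [hev σ nd hσ]
    exact List.map_congr_left fun r hr => (hF σ nd hσ r (by simpa [Nat.lt_succ_iff] using hr)).symm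
  · obtain ⟨nd, hnd, h1⟩ := (hBr r).1
    obtain ⟨σ, hσ, h2⟩ := (hmem nd).1 hnd
    exact ⟨σ, hσ, by rw [h1, hF σ nd h2 r hr]⟩
  · have := (hBr r).2 _ ((hmem _).2 ⟨σ, hσ, rfl⟩)
    rwa [hF σ _ rfl r hr] at this

end

end ModularDP

/-! ### Correctness for a single operation -/

namespace ModularDP

open RAM

section

variable {ι : Type} {E : ι → ℕ → ℕ × Sol} {z k σ : ι → ℕ} {r : ℕ}

/-- In truncated arithmetic `a + (s - a)` is the maximum of `a` and `s`: a part must meet its own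
remaining demand and also provide the guessed number of vertices. -/
theorem part_fst (is : List ι) : (part z E k σ is r).1 =
    (is.map fun i => (E i (r - k i)).1 + (σ i - (E i (r - k i)).1)).sum := by
  induction is with
  | nil => rfl
  | cons i is ih =>
    simp only [part, List.foldr_cons, addPart, List.map_cons, List.sum_cons] at ih ⊢
    rw [ih, add_comm]

theorem part_size (is : List ι) : (part z E k σ is r).2.size =
    1 + (is.map fun i => (E i (r - k i)).2.size + 1).sum := by
  induction is with
  | nil => rfl
  | cons i is ih =>
    simp only [part, List.foldr_cons, addPart, List.map_cons, List.sum_cons, Sol.size] at ih ⊢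
    rw [ih]
    omega

/-- The `e` extra vertices are distributed greedily, each part taking as many as its free capacity
allows; `x i` is the share of part `i`. -/
theorem part_emit {is : List ι} (his : is.Nodup) {e : ℕ}
    (he : e ≤ (is.map fun i => z i - ((E i (r - k i)).1 + (σ i - (E i (r - k i)).1))).sum) :
    ∃ x : ι → ℕ, (∀ i ∈ is, x i ≤ z i - ((E i (r - k i)).1 + (σ i - (E i (r - k i)).1))) ∧
      (is.map x).sum = e ∧ (part z E k σ is r).2.emit e =
        is.flatMap fun i => (E i (r - k i)).2.emit (σ i - (E i (r - k i)).1 + x i) := by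
  classical
  induction is generalizing e with
  | nil => exact ⟨fun _ => 0, by simp, by simpa [eq_comm] using he, rfl⟩
  | cons i is ih =>
    rw [List.nodup_cons] at his
    rw [List.map_cons, List.sum_cons] at he
    set c := z i - ((E i (r - k i)).1 + (σ i - (E i (r - k i)).1)) with hc
    obtain ⟨x, hx, hsum, hemit⟩ := ih his.2 (e := e - c) (by omega)
    have hne (j) (hj : j ∈ is) : j ≠ i := fun h => his.1 (h ▸ hj)
    have hupd (j) (hj : j ∈ is) : Function.update x i (e - (e - c)) j = x j :=
      Function.update_of_ne (hne j hj) _ _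
    refine ⟨Function.update x i (e - (e - c)), ?_, ?_, ?_⟩
    · intro j hj
      rcases List.mem_cons.1 hj with rfl | hj
      · rw [Function.update_self]
        omega
      · rw [hupd j hj]
        exact hx j hj
    · rw [List.map_cons, List.sum_cons, Function.update_self, List.map_congr_left hupd, hsum]
      omega
    · have : (part z E k σ (i :: is) r).2 = .cons (σ i - (E i (r - k i)).1) c (E i (r - k i)).2
          (part z E k σ is r).2 := rfl
      rw [this, Sol.emit, hemit, List.flatMap_cons, Function.update_self]
      congr 1
      rw [List.flatMap_def, List.flatMap_def]
      congr 1
      exact List.map_congr_left fun j hj => by rw [hupd j hj]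

end

open Classical in
/-- Every vertex of `W` outside of `S` has at least `r` neighbours in `S`. -/
def Sat {V : Type} (W : Finset V) (A : V → V → Prop) (r : ℕ) (S : Finset V) : Prop :=
  ∀ v ∈ W, v ∉ S → r ≤ (S.filter (A v)).card

/-- The entry `x` is correct for the demand `r` in the graph with the vertices `W` and the adjacency
relation `A`. -/
structure EntryOK {n : ℕ} (W : Finset (Fin n)) (A : Fin n → Fin n → Prop) (r : ℕ) (x : ℕ × Sol) :
    Prop where
  min : ∀ S ⊆ W, Sat W A r S → x.1 ≤ S.card
  le : x.1 ≤ W.card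
  -- All sizes up to `W.card` must be available, since a guess at an ancestor may require more
  -- vertices than the demand does.
  emit : ∀ e, x.1 + e ≤ W.card → ∃ S : List (Fin n), x.2.emit e = S.map Fin.val ∧ S.Nodup ∧
    S.toFinset ⊆ W ∧ S.length = x.1 + e ∧ Sat W A r S.toFinset
  size : x.2.size + 3 ≤ 6 * W.card

/-- The table `t` is correct for the graph with the vertices `W` and the adjacency relation `A`. -/
def TabOK {n : ℕ} (d : ℕ) (W : Finset (Fin n)) (A : Fin n → Fin n → Prop) (t : Tab) : Prop :=
  ∃ E : ℕ → ℕ × Sol, t = (W.card, (List.range (d + 1)).map E) ∧ ∀ r ≤ d, EntryOK W A r (E r)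

/-- A single vertex has no neighbours, so a positive demand forces it into the set. For demand `0`
it is left out and serves as the one possible extra vertex. -/
theorem tabOK_leaf {n : ℕ} (d : ℕ) (v : Fin n) :
    TabOK d {v} (fun _ _ => False) (leafTab (List.range (d + 1)) v) := by
  refine ⟨fun r => if 0 < r then (1, .cons 1 0 (.leaf v) .nil) else (0, .leaf v), rfl, fun r _ => ?_⟩
  dsimp only
  split_ifs with hr
  · refine ⟨fun S hS hsat => ?_, by simp, fun e he => ?_, by simp [Sol.size]⟩
    · rw [Nat.one_le_iff_ne_zero, Finset.card_ne_zero]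
      by_contra h
      rw [Finset.not_nonempty_iff_eq_empty] at h
      have := hsat v (by simp) (by simp [h])
      simp at this
      omega
    · obtain rfl : e = 0 := by simpa using he
      exact ⟨[v], by simp [Sol.emit], by simp, by simp, by simp,
        fun u hu hu' => absurd hu (by simpa using hu')⟩
  · obtain rfl : r = 0 := by omega
    refine ⟨fun S hS hsat => by simp, by simp, fun e he => ?_, by simp [Sol.size]⟩
    have : e = 0 ∨ e = 1 := by simp at he; omega
    rcases this with rfl | rfl
    · exact ⟨[], by simp [Sol.emit], by simp, by simp, by simp, fun u hu hu' => by simp⟩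
    · exact ⟨[v], by simp [Sol.emit], by simp, by simp, by simp, fun u hu hu' => by simp⟩

section

variable {n l : ℕ} {W : Fin l → Finset (Fin n)} {A : Fin l → Fin n → Fin n → Prop}
  {H : SimpleGraph (Fin l)}

/-- The adjacency relation of a substitution. -/
def SubstAdj (W : Fin l → Finset (Fin n)) (A : Fin l → Fin n → Fin n → Prop)
    (H : SimpleGraph (Fin l)) (u w : Fin n) : Prop :=
  (∃ i, A i u w) ∨ ∃ i j, H.Adj i j ∧ u ∈ W i ∧ w ∈ W j

open Classical in
/-- The entries of the adjacency matrix of an outline graph. -/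
noncomputable def entry (H : SimpleGraph (Fin l)) (i j : Fin l) : ℕ := if H.Adj i j then 1 else 0

/-- Optimality: the truncated sizes of the traces `P i` of `S` on the parts form a guess that costs
at most `S.card`. Each `P i` meets the demand left to its part, so the maximum of the table entry
and `σ i` is at most `(P i).card`. -/
theorem exists_sizes {d r : ℕ} (hr : r ≤ d) (hA : ∀ i u w, A i u w → u ∈ W i ∧ w ∈ W i)
    (hW : ∀ i j, i ≠ j → Disjoint (W i) (W j)) {E : Fin l → ℕ → ℕ × Sol}
    (hE : ∀ i, ∀ r ≤ d, EntryOK (W i) (A i) r (E i r)) {S : Finset (Fin n)}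
    (hsat : Sat (Finset.univ.biUnion W) (SubstAdj W A H) r S) :
    ∃ σ : Fin l → ℕ, (∀ i, σ i ≤ d ∧ σ i ≤ (W i).card) ∧
      (part (fun i => (W i).card) E (fun i => ∑ j, entry H j i * σ j) σ (List.finRange l) r).1 ≤
        S.card := by
  classical
  let P : Fin l → Finset (Fin n) := fun i => S.filter (· ∈ W i)
  have hPW (i) : P i ⊆ W i := fun v hv => (Finset.mem_filter.1 hv).2
  have hdis (i j) (hij : i ≠ j) : Disjoint (P i) (P j) := (hW i j hij).mono (hPW i) (hPW j)
  have hsum : ∑ i, (P i).card ≤ S.card := by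
    rw [← Finset.card_biUnion fun i _ j _ hij => hdis i j hij]
    exact Finset.card_le_card (Finset.biUnion_subset.2 fun i _ => Finset.filter_subset _ _)
  refine ⟨fun i => min (P i).card d, fun i => ⟨min_le_right _ _,
    (min_le_left _ _).trans (Finset.card_le_card (hPW i))⟩, ?_⟩
  rw [part_fst, ← Fin.sum_univ_def]
  refine le_trans (Finset.sum_le_sum fun i _ => ?_) hsum
  set k := ∑ j, entry H j i * min (P j).card d with hk
  have := (hE i (r - k) (by omega)).min (P i) (hPW i) ?_
  · omega
  intro v hv hvP
  have hvS : v ∉ S := fun h => hvP (Finset.mem_filter.2 ⟨h, hv⟩)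
  have h1 := hsat v (Finset.mem_biUnion.2 ⟨i, Finset.mem_univ _, hv⟩) hvS
  have hpart {j} (hj : v ∈ W j) : j = i := by
    by_contra h
    exact Finset.disjoint_left.1 (hW j i h) hj hv
  have h2 : S.filter (SubstAdj W A H v) ⊆ (P i).filter (A i v) ∪
      Finset.univ.biUnion fun j => if H.Adj j i then P j else ∅ := by
    intro u hu
    obtain ⟨huS, hu⟩ := Finset.mem_filter.1 hu
    rw [Finset.mem_union]
    rcases hu with ⟨j, hj⟩ | ⟨a, b, hab, ha, hb⟩
    · obtain rfl := hpart (hA j v u hj).1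
      exact Or.inl (Finset.mem_filter.2 ⟨Finset.mem_filter.2 ⟨huS, (hA j v u hj).2⟩, hj⟩)
    · obtain rfl := hpart ha
      refine Or.inr (Finset.mem_biUnion.2 ⟨b, Finset.mem_univ _, ?_⟩)
      rw [if_pos hab.symm]
      exact Finset.mem_filter.2 ⟨huS, hb⟩
  have h3 := (Finset.card_le_card h2).trans (Finset.card_union_le _ _)
  have h4 : (Finset.univ.biUnion fun j => if H.Adj j i then P j else ∅).card ≤
      ∑ j, entry H j i * (P j).card := by
    refine Finset.card_biUnion_le.trans (Finset.sum_le_sum fun j _ => ?_)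
    unfold entry
    split_ifs <;> simp
  by_cases hkr : r ≤ k
  · simp [Nat.sub_eq_zero_of_le hkr]
  -- Here `k < r ≤ d`. Every adjacent part contributes at most `k`, hence less than `d`, so the
  -- minimum with `d` was not attained at `d` and `k` is the exact number of chosen vertices in
  -- adjacent parts.
  · have h5 : ∑ j, entry H j i * (P j).card = k := by
      refine Finset.sum_congr rfl fun j _ => ?_
      have h6 : entry H j i * min (P j).card d ≤ k :=
        Finset.single_le_sum (f := fun j => entry H j i * min (P j).card d) (by simp)
          (Finset.mem_univ j)
      unfold entry at h6 ⊢
      split_ifs at h6 ⊢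
      · omega
      · simp
    omega

/-- An unchosen vertex of part `i` is adjacent to all chosen vertices of the adjacent parts, at
least `∑ σ j` in number, and these are disjoint from its neighbours inside `P i`. -/
theorem sat_substAdj {r : ℕ} (hW : ∀ i j, i ≠ j → Disjoint (W i) (W j)) {P : Fin l → Finset (Fin n)}
    (hP : ∀ i, P i ⊆ W i) {σ : Fin l → ℕ} (hσ : ∀ i, σ i ≤ (P i).card)
    (hsat : ∀ i, Sat (W i) (A i) (r - ∑ j, entry H j i * σ j) (P i)) :
    Sat (Finset.univ.biUnion W) (SubstAdj W A H) r (Finset.univ.biUnion P) := by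
  classical
  intro v hv hvP
  obtain ⟨i, -, hi⟩ := Finset.mem_biUnion.1 hv
  have h1 := hsat i v hi fun h => hvP (Finset.mem_biUnion.2 ⟨i, Finset.mem_univ _, h⟩)
  have hdis (i j) (hij : i ≠ j) : Disjoint (P i) (P j) := (hW i j hij).mono (hP i) (hP j)
  have h2 : (P i).filter (A i v) ∪ (Finset.univ.biUnion fun j => if H.Adj j i then P j else ∅) ⊆
      (Finset.univ.biUnion P).filter (SubstAdj W A H v) := by
    intro u hu
    rw [Finset.mem_filter, Finset.mem_biUnion]
    rcases Finset.mem_union.1 hu with hu | hu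
    · obtain ⟨hu, ha⟩ := Finset.mem_filter.1 hu
      exact ⟨⟨i, Finset.mem_univ _, hu⟩, Or.inl ⟨i, ha⟩⟩
    · obtain ⟨j, -, hj⟩ := Finset.mem_biUnion.1 hu
      split_ifs at hj with hji
      · exact ⟨⟨j, Finset.mem_univ _, hj⟩, Or.inr ⟨i, j, hji.symm, hi, hP j hj⟩⟩
      · simp at hj
  have h3 := Finset.card_le_card h2
  rw [Finset.card_union_of_disjoint, Finset.card_biUnion] at h3
  · have h4 : ∑ j, entry H j i * σ j ≤ ∑ j, (if H.Adj j i then P j else ∅).card := by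
      refine Finset.sum_le_sum fun j _ => ?_
      have := hσ j
      unfold entry
      split_ifs <;> simp [this]
    omega
  · intro a _ b _ hab
    refine (hdis a b hab).mono ?_ ?_ <;> dsimp only <;> split_ifs <;> simp
  · refine Finset.disjoint_biUnion_right _ _ _ |>.2 fun j _ => ?_
    split_ifs with hji
    · exact (hdis i j hji.ne').mono_left (Finset.filter_subset _ _)
    · simp

theorem entryOK_part {d r : ℕ} (hl : 2 ≤ l) (hr : r ≤ d)
    (hW : ∀ i j, i ≠ j → Disjoint (W i) (W j)) {E : Fin l → ℕ → ℕ × Sol}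
    (hE : ∀ i, ∀ r ≤ d, EntryOK (W i) (A i) r (E i r)) {σ : Fin l → ℕ}
    (hσ : ∀ i, σ i ≤ d ∧ σ i ≤ (W i).card) {x : ℕ × Sol}
    (hx : x = part (fun i => (W i).card) E (fun i => ∑ j, entry H j i * σ j) σ (List.finRange l) r)
    (hmin : ∀ S ⊆ Finset.univ.biUnion W, Sat (Finset.univ.biUnion W) (SubstAdj W A H) r S →
      x.1 ≤ S.card) : EntryOK (Finset.univ.biUnion W) (SubstAdj W A H) r x := by
  classical
  have hcard : (Finset.univ.biUnion W).card = ∑ i, (W i).card :=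
    Finset.card_biUnion fun i _ j _ hij => hW i j hij
  have hle (i) : (E i (r - ∑ j, entry H j i * σ j)).1 ≤ (W i).card :=
    (hE i (r - ∑ j, entry H j i * σ j) (by omega)).le
  have hx1 : x.1 = ∑ i, ((E i (r - ∑ j, entry H j i * σ j)).1 +
      (σ i - (E i (r - ∑ j, entry H j i * σ j)).1)) := by
    rw [hx, part_fst, ← Fin.sum_univ_def]
  refine ⟨hmin, ?_, fun e he => ?_, ?_⟩
  · rw [hx1, hcard]
    refine Finset.sum_le_sum fun i _ => ?_
    have := hle i
    have := (hσ i).2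
    omega
  · have he' : e ≤ ((List.finRange l).map fun i => (W i).card -
        ((E i (r - ∑ j, entry H j i * σ j)).1 +
          (σ i - (E i (r - ∑ j, entry H j i * σ j)).1))).sum := by
      rw [← Fin.sum_univ_def, Finset.sum_tsub_distrib, ← hx1, ← hcard]
      · omega
      · intro i _
        have := hle i
        have := (hσ i).2
        omega
    obtain ⟨y, hy, hsum, hemit⟩ := part_emit (σ := σ) (List.nodup_finRange l) he'
    rw [← Fin.sum_univ_def] at hsum
    choose L hL using fun i => (hE i (r - ∑ j, entry H j i * σ j) (by omega)).emit
      (σ i - (E i (r - ∑ j, entry H j i * σ j)).1 + y i) (by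
        have := hy i (by simp)
        have := hle i
        have := (hσ i).2
        omega)
    have hset : ((List.finRange l).flatMap L).toFinset =
        Finset.univ.biUnion fun i => (L i).toFinset := by
      ext v
      simp
    refine ⟨(List.finRange l).flatMap L, ?_, ?_, ?_, ?_, ?_⟩
    · rw [hx, hemit, List.map_flatMap]
      simp only [(hL _).1]
    · rw [List.nodup_flatMap]
      refine ⟨fun i _ => (hL i).2.1, (List.nodup_finRange l).imp fun {i j} hij => ?_⟩
      rw [Function.onFun, List.disjoint_iff_ne]
      rintro a ha b hb rfl
      exact Finset.disjoint_left.1 (hW i j hij) ((hL i).2.2.1 (by simpa using ha))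
        ((hL j).2.2.1 (by simpa using hb))
    · rw [hset]
      exact Finset.biUnion_mono fun i _ => (hL i).2.2.1
    · rw [List.length_flatMap, ← Fin.sum_univ_def, hx1, ← hsum, ← Finset.sum_add_distrib]
      refine Finset.sum_congr rfl fun i _ => ?_
      rw [(hL i).2.2.2.1]
      omega
    · rw [hset]
      refine sat_substAdj hW (fun i => (hL i).2.2.1) (σ := σ) (fun i => ?_)
        fun i => (hL i).2.2.2.2
      rw [List.toFinset_card_of_nodup (hL i).2.1, (hL i).2.2.2.1]
      omega
  · rw [hx, part_size, hcard, ← Fin.sum_univ_def, Finset.mul_sum]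
    -- Each part leaves a slack of `2` after its `cons` cell is counted. The `2 * l ≥ 4` in total
    -- pay for the final `nil` and the required slack `3`.
    have h : ∑ i, ((E i (r - ∑ j, entry H j i * σ j)).2.size + 1) + 2 * l ≤
        ∑ i, 6 * (W i).card := by
      have : ∑ _i : Fin l, 2 = 2 * l := by simp [mul_comm]
      rw [← this, ← Finset.sum_add_distrib]
      exact Finset.sum_le_sum fun i _ => (hE i (r - ∑ j, entry H j i * σ j) (by omega)).size
    omega

theorem tabOK_subst {d : ℕ} (hl : 2 ≤ l) (hA : ∀ i u w, A i u w → u ∈ W i ∧ w ∈ W i)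
    (hW : ∀ i j, i ≠ j → Disjoint (W i) (W j)) {t : Fin l → Tab}
    (ht : ∀ i, TabOK d (W i) (A i) (t i)) :
    TabOK d (Finset.univ.biUnion W) (SubstAdj W A H) (comb (List.range (d + 1))
      ((List.finRange l).map t) ((List.finRange l).map fun i => (List.finRange l).map (entry H i))) := by
  choose E hE using ht
  obtain rfl : t = fun i => ((W i).card, (List.range (d + 1)).map (E i)) :=
    funext fun i => (hE i).1
  obtain ⟨B, hB, h⟩ := comb_map (d := d) (E := E) (h := entry H) (z := fun i => (W i).card)
    (fun i j => by unfold entry; split_ifs <;> simp) (List.nodup_finRange l)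
  simp only [← Fin.sum_univ_def] at hB h
  refine ⟨B, ?_, fun r hr => ?_⟩
  · rw [hB, Finset.card_biUnion fun i _ j _ hij => hW i j hij]
  · obtain ⟨⟨σ, hσ, hx⟩, hmin⟩ := h r hr
    refine entryOK_part hl hr hW (fun i => (hE i).2) (fun i => hσ i (by simp)) hx fun S _ hS => ?_
    obtain ⟨τ, hτ, hle⟩ := exists_sizes hr hA hW (fun i => (hE i).2) hS
    exact (hmin τ fun i _ => hτ i).trans hle

end

end ModularDP

/-! ### Correctness and cost of the algorithm -/

namespace ModularDP

open RAM

/-- `K` is a credit that every child leaves unspent; the credits of all children add up for use at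
their parent. -/
theorem iterate_kids {α ι : Type} {f : List α × List ℕ → List α × List ℕ}
    {g : List α × List ℕ → ℕ} {code : ι → List ℕ} {t : ι → α} {m B : ι → ℕ} {K : ℕ}
    (h : ∀ i stack rest, f^[m i] (stack, code i ++ rest) = (t i :: stack, rest) ∧
      iterCost f g (m i) (stack, code i ++ rest) + K ≤ m i + B i) (js : List ι) (stack : List α)
    (rest : List ℕ) :
    f^[(js.map m).sum] (stack, (js.map code).flatten ++ rest) =
      ((js.map t).reverse ++ stack, rest) ∧
    iterCost f g (js.map m).sum (stack, (js.map code).flatten ++ rest) + js.length * K ≤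
      (js.map m).sum + (js.map B).sum := by
  induction js generalizing stack with
  | nil => simp [iterCost]
  | cons j js ih =>
    obtain ⟨h1, h2⟩ := h j stack ((js.map code).flatten ++ rest)
    obtain ⟨h3, h4⟩ := ih (t j :: stack)
    simp only [List.map_cons, List.sum_cons, List.flatten_cons, List.append_assoc,
      List.length_cons, add_mul, one_mul]
    constructor
    · rw [add_comm, Function.iterate_add_apply, h1, h3]
      simp
    · rw [iterCost_add, h1]
      omega

/-- The sequence `code` of symbols makes the algorithm produce a correct table of the graph with the
vertices `W` and the adjacency relation `A`, at a cost that is proportional to the size of `W`. -/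
structure ParseOK {n : ℕ} (d X : ℕ) (W : Finset (Fin n)) (A : Fin n → Fin n → Prop)
    (code : List ℕ) : Prop where
  card : 2 * W.card ≤ code.length
  -- The term `40 * X` on the left, here and in `run`, is a credit passed on to the parent
  -- operation.
  length : code.length + 40 * X ≤ 80 * X * W.card
  run : ∃ m ≤ code.length, ∃ t, TabOK d W A t ∧ ∀ stack rest,
    (parseStep (List.range (d + 1)))^[m] (stack, code ++ rest) = (t :: stack, rest) ∧
    iterCost (parseStep (List.range (d + 1))) (parseStepCost (List.range (d + 1))) m
      (stack, code ++ rest) + 40 * X ≤ m + 80 * X * W.card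

theorem parseOK_leaf {n d X : ℕ} (hX : d + 1 ≤ X) (v : Fin n) :
    ParseOK d X {v} (fun _ _ => False) [0, (v : ℕ)] := by
  refine ⟨by simp, by simp; omega, 1, by simp, _, tabOK_leaf d v, fun stack rest => ⟨rfl, ?_⟩⟩
  have : parseStepCost (List.range (d + 1)) (stack, [0, (v : ℕ)] ++ rest) = d + 1 := by
    simp [parseStepCost]
  simp only [iterCost, this, Finset.card_singleton]
  omega

/-- The `l` children leave a credit of `40 * l * X`. The operation itself spends at most `20 * l *
X`, and since `l ≥ 2` the remaining `20 * l * X` cover the credit `40 * X` owed to the parent. -/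
theorem parseOK_subst {n d w l : ℕ} (hd : 0 < d) (hl : 2 ≤ l) (hlw : l ≤ w)
    {W : Fin l → Finset (Fin n)} {A : Fin l → Fin n → Fin n → Prop} {H : SimpleGraph (Fin l)}
    (hA : ∀ i u w, A i u w → u ∈ W i ∧ w ∈ W i) (hW : ∀ i j, i ≠ j → Disjoint (W i) (W j))
    {code : Fin l → List ℕ} (h : ∀ i, ParseOK d (d * (d + 1) ^ w) (W i) (A i) (code i))
    {tail : List ℕ} (h0 : 1 ≤ tail.length) (htail : tail.length ≤ l * l + 2)
    (hstep : ∀ stack rest, parseStep (List.range (d + 1)) (stack, tail ++ rest) =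
        (reduce (List.range (d + 1)) l
          ((List.finRange l).map fun i => (List.finRange l).map (entry H i)) stack, rest) ∧
      parseStepCost (List.range (d + 1)) (stack, tail ++ rest) ≤ l * (l + 1) +
        reduceCost (List.range (d + 1)) l
          ((List.finRange l).map fun i => (List.finRange l).map (entry H i)) stack) :
    ParseOK d (d * (d + 1) ^ w) (Finset.univ.biUnion W) (SubstAdj W A H)
      (((List.finRange l).map code).flatten ++ tail) := by
  set X := d * (d + 1) ^ w with hX
  set rows := (List.finRange l).map fun i => (List.finRange l).map (entry H i) with hrows
  have hXl : d * (d + 1) ^ l ≤ X := Nat.mul_le_mul_left _ (Nat.pow_le_pow_right (by omega) hlw)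
  -- Through `l < 2 ^ l ≤ (d + 1) ^ l`, the quadratic cost of reading the adjacency matrix is
  -- absorbed into `l * X`.
  have hlX : l + 1 ≤ X := by
    have h1 : l < 2 ^ l := Nat.lt_two_pow_self
    have h2 : 2 ^ l ≤ (d + 1) ^ l := Nat.pow_le_pow_left (by omega) l
    nlinarith
  have hcard : (Finset.univ.biUnion W).card = ∑ i, (W i).card :=
    Finset.card_biUnion fun i _ j _ hij => hW i j hij
  have hlen : (((List.finRange l).map code).flatten ++ tail).length =
      ∑ i, (code i).length + tail.length := by
    rw [List.length_append, List.length_flatten, List.map_map, Fin.sum_univ_def]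
    rfl
  have h20 : l * (l + 1) + l + (3 * l + 12 * l * X) ≤ 20 * (l * X) := by nlinarith
  choose m hm t ht hrun using fun i => (h i).run
  refine ⟨?_, ?_, ∑ i, m i + 1, ?_, comb (List.range (d + 1)) ((List.finRange l).map t) rows,
    tabOK_subst hl hA hW ht, fun stack rest => ?_⟩
  · rw [hcard, hlen, Finset.mul_sum]
    exact (Finset.sum_le_sum fun i _ => (h i).card).trans (Nat.le_add_right _ _)
  · rw [hcard, hlen, Finset.mul_sum]
    have h1 : ∑ i, ((code i).length + 40 * X) ≤ ∑ i, 80 * X * (W i).card :=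
      Finset.sum_le_sum fun i _ => (h i).length
    rw [Finset.sum_add_distrib, Finset.sum_const, Finset.card_univ, Fintype.card_fin,
      smul_eq_mul] at h1
    nlinarith
  · rw [hlen]
    exact Nat.add_le_add (Finset.sum_le_sum fun i _ => hm i) h0
  · obtain ⟨h1, h2⟩ := iterate_kids (B := fun i => 80 * X * (W i).card) hrun (List.finRange l) stack
      (tail ++ rest)
    rw [← Fin.sum_univ_def] at h1 h2
    -- The last child lies on top of the stack, so the reversal in `splitRev` restores the order of
    -- the children.
    have hsplit : splitRev l (((List.finRange l).map t).reverse ++ stack) =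
        ((List.finRange l).map t, stack) := by
      have := splitRev_append ((List.finRange l).map t).reverse stack
      simpa using this
    obtain ⟨h3, h4⟩ := hstep (((List.finRange l).map t).reverse ++ stack) rest
    rw [List.append_assoc]
    constructor
    · rw [add_comm (∑ i, m i), Function.iterate_add_apply, h1, Function.iterate_one, h3, reduce,
        hsplit]
    · rw [iterCost_add, h1]
      simp only [iterCost]
      have h5 := combCost_le (D := List.range (d + 1)) (kids := (List.finRange l).map t)
        (rows := rows) (l := l) (List.length_range) hd hl (by simp) (by simp [hrows]) (by simp [hrows])
      rw [reduceCost, hsplit] at h4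
      rw [List.length_finRange, ← Fin.sum_univ_def, ← Finset.mul_sum, ← hcard] at h2
      have h6 : 12 * l * (d * (d + 1) ^ l) ≤ 12 * l * X := Nat.mul_le_mul_left _ hXl
      nlinarith

theorem entry_bot : (List.finRange 2).map (fun i => (List.finRange 2).map
    (entry (⊥ : SimpleGraph (Fin 2)) i)) = [[0, 0], [0, 0]] := by
  simp [List.finRange, entry]

theorem entry_top : (List.finRange 2).map (fun i => (List.finRange 2).map
    (entry (⊤ : SimpleGraph (Fin 2)) i)) = [[0, 1], [1, 0]] := by
  simp [List.finRange, entry]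

end ModularDP

/-! ### Induction over the parse tree -/

namespace ParseTree

open ModularDP RAM

theorem Adj.mem {V : Type*} {T : ParseTree V} {u w : V} (h : T.Adj u w) :
    u ∈ T.verts ∧ w ∈ T.verts := by
  induction T with
  | leaf v => exact h.elim
  | union l r ihl ihr =>
    rcases h with h | h
    · exact ⟨Or.inl (ihl h).1, Or.inl (ihl h).2⟩
    · exact ⟨Or.inr (ihr h).1, Or.inr (ihr h).2⟩
  | join l r ihl ihr =>
    rcases h with h | h | ⟨h, h'⟩ | ⟨h, h'⟩
    · exact ⟨Or.inl (ihl h).1, Or.inl (ihl h).2⟩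
    · exact ⟨Or.inr (ihr h).1, Or.inr (ihr h).2⟩
    · exact ⟨Or.inl h, Or.inr h'⟩
    · exact ⟨Or.inr h, Or.inl h'⟩
  | subst l H c ih =>
    rcases h with ⟨i, h⟩ | ⟨i, j, -, h, h'⟩
    · exact ⟨Set.mem_iUnion.2 ⟨i, (ih i h).1⟩, Set.mem_iUnion.2 ⟨i, (ih i h).2⟩⟩
    · exact ⟨Set.mem_iUnion.2 ⟨i, h⟩, Set.mem_iUnion.2 ⟨j, h'⟩⟩

open Classical in
/-- The finite set of the vertices of the constructed graph. -/
noncomputable def vertFinset {n : ℕ} (T : ParseTree (Fin n)) : Finset (Fin n) :=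
  Finset.univ.filter (· ∈ T.verts)

@[simp] theorem mem_vertFinset {n : ℕ} {T : ParseTree (Fin n)} {v : Fin n} :
    v ∈ T.vertFinset ↔ v ∈ T.verts := by
  simp [vertFinset]

theorem disjoint_vertFinset {n : ℕ} {T T' : ParseTree (Fin n)} (h : Disjoint T.verts T'.verts) :
    Disjoint T.vertFinset T'.vertFinset := by
  rw [Finset.disjoint_left]
  intro v hv hv'
  exact Set.disjoint_left.1 h (mem_vertFinset.1 hv) (mem_vertFinset.1 hv')

theorem two_le_width {V : Type*} : ∀ {T : ParseTree V}, T.WellFormed → 2 ≤ T.width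
  | leaf _, _ => le_rfl
  | union _ _, h => (two_le_width h.1).trans (le_max_left _ _)
  | join _ _, h => (two_le_width h.1).trans (le_max_left _ _)
  | subst _ _ _, h => h.1.trans (le_max_left _ _)

/-- Union and join are treated as substitutions into the empty (`⊥`) and the complete (`⊤`) graph on
two vertices. This is where the value `2` as lower bound for the width enters. -/
theorem parseOK_pair {n d w : ℕ} (hd : 0 < d) (hw : 2 ≤ w) {l r : ParseTree (Fin n)}
    (hdis : Disjoint l.verts r.verts) (hl : ParseOK d (d * (d + 1) ^ w) l.vertFinset l.Adj l.encode)
    (hr : ParseOK d (d * (d + 1) ^ w) r.vertFinset r.Adj r.encode) (H : SimpleGraph (Fin 2)) {s : ℕ}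
    (hstep : ∀ stack rest, parseStep (List.range (d + 1)) (stack, [s] ++ rest) =
        (reduce (List.range (d + 1)) 2
          ((List.finRange 2).map fun i => (List.finRange 2).map (entry H i)) stack, rest) ∧
      parseStepCost (List.range (d + 1)) (stack, [s] ++ rest) =
        reduceCost (List.range (d + 1)) 2
          ((List.finRange 2).map fun i => (List.finRange 2).map (entry H i)) stack)
    {T : ParseTree (Fin n)} (hT : T.verts = l.verts ∪ r.verts)
    (hadj : ∀ u w, T.Adj u w ↔ l.Adj u w ∨ r.Adj u w ∨ (H.Adj 0 1 ∧
      ((u ∈ l.verts ∧ w ∈ r.verts) ∨ (u ∈ r.verts ∧ w ∈ l.verts)))) :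
    ParseOK d (d * (d + 1) ^ w) T.vertFinset T.Adj (l.encode ++ r.encode ++ [s]) := by
  have := parseOK_subst hd le_rfl hw (W := fun i => (![l, r] i).vertFinset)
    (A := fun i => (![l, r] i).Adj) (H := H) (code := fun i => (![l, r] i).encode) (tail := [s])
    (fun i u w h => by simpa using h.mem) ?_ ?_ (by simp) (by simp)
    fun stack rest => ⟨(hstep stack rest).1, (hstep stack rest).2.le.trans (Nat.le_add_left _ _)⟩
  · convert this using 1
    · ext v
      simp [hT]
    · ext u w
      simp [hadj, SubstAdj, H.adj_comm 1 0]
      tauto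
    · simp [List.finRange]
  · intro i j hij
    refine disjoint_vertFinset ?_
    fin_cases i <;> fin_cases j <;> simp_all [disjoint_comm]
  · intro i
    fin_cases i
    · exact hl
    · exact hr

theorem parseOK {n d w : ℕ} (hd : 0 < d) (hw : 2 ≤ w) {T : ParseTree (Fin n)} (hT : T.WellFormed)
    (hTw : T.width ≤ w) : ParseOK d (d * (d + 1) ^ w) T.vertFinset T.Adj T.encode := by
  induction T with
  | leaf v =>
    have hX : d + 1 ≤ d * (d + 1) ^ w :=
      (Nat.le_self_pow (by omega) (d + 1)).trans (Nat.le_mul_of_pos_left _ hd)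
    have hv : (leaf v).vertFinset = {v} := by
      ext u
      simp [verts]
    rw [hv]
    exact parseOK_leaf hX v
  | union l r ihl ihr =>
    rw [width, max_le_iff] at hTw
    refine parseOK_pair hd hw hT.2.2 (ihl hT.1 hTw.1) (ihr hT.2.1 hTw.2) ⊥ (fun stack rest => ?_)
      rfl fun u w => ?_
    · rw [entry_bot]
      exact ⟨rfl, rfl⟩
    · simp [Adj]
  | join l r ihl ihr =>
    rw [width, max_le_iff] at hTw
    refine parseOK_pair hd hw hT.2.2 (ihl hT.1 hTw.1) (ihr hT.2.1 hTw.2) ⊤ (fun stack rest => ?_)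
      rfl fun u w => ?_
    · rw [entry_top]
      exact ⟨rfl, rfl⟩
    · simp [Adj]
  | subst l H c ih =>
    rw [width, max_le_iff, Finset.sup_le_iff] at hTw
    have := parseOK_subst hd hT.1 hTw.1 (W := fun i => (c i).vertFinset)
      (A := fun i => (c i).Adj) (H := H) (code := fun i => (c i).encode)
      (tail := [3, l] ++ ((List.finRange l).map fun i => (List.finRange l).map (entry H i)).flatten)
      (fun i u w h => by simpa using h.mem) (fun i j hij => disjoint_vertFinset (hT.2.2 i j hij))
      (fun i => ih i (hT.2.1 i) (hTw.2 i (Finset.mem_univ i))) (by simp) ?_ fun stack rest => ?_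
    · convert this using 1
      · ext v
        simp [verts]
      · ext u w
        simp [Adj, SubstAdj]
      · rw [encode, List.ofFn_eq_map, List.ofFn_eq_map, List.append_assoc]
        simp only [List.ofFn_eq_map]
        rfl
    · rw [List.length_append, List.length_flatten, List.map_map]
      simp [Function.comp_def]
      omega
    · have h := readRows_append l
        ((List.finRange l).map fun i => (List.finRange l).map (entry H i)) (by simp) (by simp) rest
      simp only [parseStep, parseStepCost, List.cons_append, List.nil_append, lcase_cons, h]
      simp

end ParseTree

/-! ### From the table at the root to a minimum dominating set -/

theorem isDominatingSet_one_iff {n : ℕ} {G : SimpleGraph (Fin n)} {A : Fin n → Fin n → Prop}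
    (hA : ∀ u w, G.Adj u w ↔ A u w) (d : ℕ) (S : Finset (Fin n)) :
    IsDominatingSet G d 1 S ↔ ModularDP.Sat Finset.univ A d S := by
  classical
  have h (v : Fin n) : {u : Fin n | u ∈ S ∧ u ≠ v ∧ G.edist v u ≤ ((1 : ℕ) : ℕ∞)} =
      S.filter (A v) := by
    ext u
    simp only [Set.mem_ofPred_eq, Finset.coe_filter, ← hA, Nat.cast_one]
    refine and_congr_right fun _ => ⟨fun ⟨h1, h2⟩ => ?_, fun h => ⟨h.ne', ?_⟩⟩
    · refine SimpleGraph.edist_eq_one_iff_adj.1 (le_antisymm h2 ?_)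
      exact Order.one_le_iff_pos.2 (SimpleGraph.edist_pos_of_ne h1.symm)
    · exact (SimpleGraph.edist_eq_one_iff_adj.2 h).le
  simp only [IsDominatingSet, ModularDP.Sat, h, Set.ncard_coe_finset, Finset.mem_univ, true_imp_iff]

open ModularDP RAM in
theorem ParseTree.IsParseTreeOf.solve {n d : ℕ} {G : SimpleGraph (Fin n)} {T : ParseTree (Fin n)}
    (hd : 0 < d) (hT : T.IsParseTreeOf G) :
    ∃ out : List (Fin n), ModularDP.solve (d :: T.encode) = out.map Fin.val ∧ out.Nodup ∧
      IsMinimumDominatingSet G d 1 out.toFinset ∧ out.length ≤ T.encode.length ∧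
      solveCost (d :: T.encode) + T.encode.length + 2 ≤ 1000 * (n * (d * (d + 1) ^ T.width)) := by
  have hw := two_le_width hT.1
  obtain ⟨hcard, hlen, m, hm, t, ⟨E, rfl, hE⟩, hrun⟩ := parseOK hd hw hT.1 le_rfl
  have hV : T.vertFinset = Finset.univ := by
    ext v
    simp [hT.2.1 v]
  set X := d * (d + 1) ^ T.width with hX
  rw [hV, Finset.card_univ, Fintype.card_fin] at hcard hlen hrun
  rw [hV] at hE
  obtain ⟨hrun, hcost⟩ := hrun [] []
  rw [List.append_nil] at hrun hcost
  have hdX : d + 1 ≤ X :=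
    (Nat.le_self_pow (by omega) (d + 1)).trans (Nat.le_mul_of_pos_left _ hd)
  have hparse : parse (List.range (d + 1)) T.encode =
      ([(n, (List.range (d + 1)).map E)], []) := by
    -- One parsing step may consume several symbols, so the tree is finished after `m` rounds; the
    -- other rounds find no input and leave the state fixed.
    rw [parse, List.foldl_const, ← Nat.sub_add_cancel hm, Function.iterate_add_apply, hrun]
    exact Function.iterate_fixed rfl _
  have hfinal : final (parse (List.range (d + 1)) T.encode).1 = (E d).2 := by
    rw [hparse, final]
    simp [List.range_succ]
  obtain ⟨hmin, hle, hemit, hsize⟩ := hE d le_rfl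
  rw [Finset.card_univ, Fintype.card_fin] at hle hsize
  obtain ⟨S, hS, hnodup, -, hSlen, hsat⟩ := hemit 0 (by simpa using hle)
  refine ⟨S.reverse, ?_, List.nodup_reverse.2 hnodup, ⟨?_, fun S' hS' => ?_⟩, ?_, ?_⟩
  · rw [ModularDP.solve, lcase_cons, hfinal, emitAll_eq _ _ (by omega), hS, List.map_reverse]
  · rw [isDominatingSet_one_iff hT.2.2, List.toFinset_reverse]
    exact hsat
  · rw [isDominatingSet_one_iff hT.2.2] at hS'
    rw [List.toFinset_reverse, List.toFinset_card_of_nodup hnodup, hSlen]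
    exact hmin S' (Finset.subset_univ _) hS'
  · rw [List.length_reverse]
    omega
  · have h1 : iterCost (parseStep (List.range (d + 1))) (parseStepCost (List.range (d + 1)))
        T.encode.length ([], T.encode) + 40 * X ≤ T.encode.length + 80 * X * n := by
      obtain ⟨k, hk⟩ := Nat.exists_eq_add_of_le hm
      have hk' : iterCost (parseStep (List.range (d + 1))) (parseStepCost (List.range (d + 1))) k
          ([(n, (List.range (d + 1)).map E)], []) = k := by
        apply iterCost_fixed <;> rfl
      rw [hk, iterCost_add, hrun, hk']
      omega
    rw [solveCost, lcase_cons, hparse, foldCost_const, lcase_cons, List.length_map,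
      List.length_range]
    -- The credit in `hlen` is positive and would exceed the bound `0` for `n = 0`.
    have hn : 0 < n := by
      rcases Nat.eq_zero_or_pos n with rfl | h
      · simp at hlen; omega
      · exact h
    have : X ≤ n * X := Nat.le_mul_of_pos_left _ hn
    nlinarith

theorem mainTheorem9 :
    ∃ (prog : RAM.Program) (C : ℕ),
      ∀ (n : ℕ) (G : SimpleGraph (Fin n)) (T : ParseTree (Fin n)) (d : ℕ),
        0 < d → T.IsParseTreeOf G → T.width = modularWidth G →
          ∃ (out : List (Fin n)) (time : ℕ),
            RAM.Computes prog (d :: T.encode) (out.map Fin.val) time ∧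
            time ≤ C * (n * d * (d + 1) ^ modularWidth G) ∧
            out.Nodup ∧ IsMinimumDominatingSet G d 1 out.toFinset := by
  obtain ⟨prog, C, hprog⟩ := RAM.run_solve.computes
  refine ⟨prog, C * 1000, fun n G T d hd hT hw => ?_⟩
  obtain ⟨out, hout, hnodup, hdom, hlen, hcost⟩ := hT.solve hd
  obtain ⟨time, hcomp, htime⟩ := hprog (d :: T.encode) (by simp [hout]; omega)
  refine ⟨out, time, hout ▸ hcomp, htime.trans ?_, hnodup, hdom⟩
  rw [← hw, mul_assoc C, mul_assoc n]
  exact Nat.mul_le_mul_left _ (le_trans (by simp; omega) hcost)
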